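/- Let $r\ge 1$. The semidiscrete Toda lattice corresponding to the Lie algebra $C_r$ is the semidiscrete exponential system for functions $u_n(j)$, $n\in\mathbb Z$, $0\le j\le r-1$, of $x\in\mathbb R$, $$u_{n,x}(j)-u_{n+1,x}(j)=\exp\Big(\sum_{k<j}a_{jk}u_n(k)+\tfrac{a_{jj}}2\big(u_n(j)+u_{n+1}(j)\big)+\sum_{k>j}a_{jk}u_{n+1}(k)\Big),$$ where $-(a_{jk})$ is the Cartan matrix of type $C_r$ with the nodes numbered starting from the long simple root (so $a_{jj}=-2$, $a_{j,j\pm1}=1$ except $a_{01}=2$, and all other entries are $0$). Solutions are smooth in $x$ near a point. The semidiscrete Toda lattice of the series $A$ with sites $lo\le j\le hi$ is $$q_{n,x}(j)-q_{n+1,x}(j)=h_n(j)-h_n(j-1),\qquad h_n(j)=\exp\big(q_{n+1}(j+1)-q_n(j)\big)\ (lo\le j<hi),\qquad h_n(lo-1)=h_n(hi)=0.$$ An $n$-integral of order $d$ of the $C_r$ lattice is a smooth function $I(u_n,u_{n,x},\dots,u_n^{(d)})$ that really depends on $u_n^{(d)}$ and whose value on solutions does not change under $n\mapsto n+1$. An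 $x$-integral of order $d$ is a smooth function $J(u_n,u_{n+1},\dots,u_{n+d})$ that really depends on $u_n$ and on $u_{n+d}$ and whose total $x$-derivative vanishes on solutions. Integrals $F_1,\dots,F_k$ of orders $d_1,\dots,d_k$ are essentially independent if the matrix with rows $\partial F_i/\partial u_n^{(d_i)}$ (for $n$-integrals), respectively $\partial F_i/\partial u_{n+d_i}$ (for $x$-integrals), has rank $k$ at every point. The lattice is Darboux integrable if it has $r$ essentially independent $n$-integrals and $r$ essentially independent $x$-integrals. Then the following hold. 1. For every solution of the $A$-series lattice with sites $-r+1\le j\le r$, the coefficients (of the powers of $\partial_x$) of $$\mathcal B=(\partial_x-q_{n,x}(r))(\partial_x-q_{n,x}(r-1))\cdots(\partial_x-q_{n,x}(-r+1))$$ do not depend on $n$, and the coefficients (of the powers of the shift $T:n\mapsto n+1$) of $$\mathcal A=(T+e^{q_n(-r+1)-q_{n+1}(-r+1)})\cdots(T+e^{q_n(r)-q_{n+1}(r)})$$ have zero derivative with respect to $x$. 2. Given functions $u_n(j)$, $0\le j<r$, put $u_n(-j)=u_{n+j}(j)$ for $0\le j<r$, $u_n(j)=0$ for $|j|\ge r$,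 and $q_n(j)=u_n(j)-u_n(j-1)$ for $-r+1\le j\le r$. Then $h_n(-j)=h_{n+j}(j)$ for all $n,j$, and $u$ solves the $C_r$ lattice if and only if $q$ solves the $A$-series lattice with sites $-r+1\le j\le r$. 3. Under the substitution of 2, some $r$ distinct coefficients of $\mathcal B$ among those of $\partial_x^0,\dots,\partial_x^{2r-1}$ become, on solutions, essentially independent $n$-integrals of the $C_r$ lattice, and some $r$ distinct coefficients of $\mathcal A$ among those of $T^0,\dots,T^{2r-1}$ become essentially independent $x$-integrals of the $C_r$ lattice. 4. In particular, the semidiscrete Toda lattice of the series $C$ is Darboux integrable. -/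

import Mathlib

open scoped Topology ContDiff

noncomputable section

namespace SemidiscreteToda

/-! ### Semidiscrete exponential systems -/

/-- The exponent of the `j`-th equation of the semidiscrete exponential system with matrix `K`:
`∑_{k<j} K j k * v k + (K j j / 2) * (v j + w j) + ∑_{k>j} K j k * w k`,
where `v` stands for `u_n` and `w` for `u_{n+1}`. -/
def exponent {r : ℕ} (K : Matrix (Fin r) (Fin r) ℝ) (v w : Fin r → ℝ) (j : Fin r) : ℝ :=
  (∑ k ∈ Finset.Iio j, K j k * v k) + K j j / 2 * (v j + w j) + ∑ k ∈ Finset.Ioi j, K j k * w k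

/-- `u = (u_n)_{n ∈ ℤ}` is a smooth solution near `x₀` of the semidiscrete exponential system
`u_{n,x}(j) - u_{n+1,x}(j) = exp (…)`. The neighbourhood of `x₀` may depend on `n`, so that
solutions with arbitrary data `u_0` (near `x₀`) and `u_n(x₀)`, `n ≠ 0`, exist. -/
def IsExpSolution {r : ℕ} (K : Matrix (Fin r) (Fin r) ℝ) (u : ℤ → ℝ → Fin r → ℝ) (x₀ : ℝ) :
    Prop :=
  (∀ n, ∀ᶠ x in 𝓝 x₀, ContDiffAt ℝ ∞ (u n) x) ∧
  ∀ n, ∀ᶠ x in 𝓝 x₀, ∀ j,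
    deriv (u n) x j - deriv (u (n + 1)) x j = Real.exp (exponent K (u n x) (u (n + 1) x) j)

/-- The matrix of the semidiscrete Toda lattice of the series `C`. In the sign convention
`h_n(j) = exp (u_{n+1}(j+1) - u_{n+1}(j) - u_n(j) + u_n(j-1))` of the Toda lattice it is minus the
Cartan matrix of type `C_r`, with the nodes numbered from the long simple root on:
the first row is `(-2, 2, 0, …)`, the following ones are `(…, 0, 1, -2, 1, 0, …)`. -/
def cMatrix (r : ℕ) : Matrix (Fin r) (Fin r) ℝ :=
  Matrix.of fun j k => -((CartanMatrix.C r j.rev k.rev : ℤ) : ℝ)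

/-! ### Integrals and Darboux integrability -/

/-- The jet `(u(x), u'(x), …, u^{(d)}(x))`. -/
def jet {r : ℕ} (d : ℕ) (u : ℝ → Fin r → ℝ) (x : ℝ) : Fin (d + 1) → Fin r → ℝ :=
  fun i => iteratedDeriv i u x

/-- The partial derivatives of `F(z_0, …, z_d)`, where `z_i ∈ ℝ^r`, with respect to the coordinates
of `z_i`, taken at the first `d + 1` entries of the sequence `p`. -/
def partialAt {r d : ℕ} (F : (Fin (d + 1) → Fin r → ℝ) → ℝ) (i : Fin (d + 1))
    (p : ℕ → Fin r → ℝ) (j : Fin r) : ℝ :=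
  fderiv ℝ F (fun l => p l) (Pi.single i (Pi.single j 1))

/-- `I(u_n, u_{n,x}, …, u_n^{(d)})` is an `n`-integral of order `d`: it is smooth, really depends
on derivatives of order `d`, and on solutions its value does not change under `n ↦ n + 1`. -/
structure IsNIntegral {r : ℕ} (K : Matrix (Fin r) (Fin r) ℝ) (d : ℕ)
    (I : (Fin (d + 1) → Fin r → ℝ) → ℝ) : Prop where
  smooth : ContDiff ℝ ∞ I
  depends : ∃ p j, partialAt I (Fin.last d) p j ≠ 0
  invariant : ∀ (u : ℤ → ℝ → Fin r → ℝ) (x₀ : ℝ), IsExpSolution K u x₀ →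
    ∀ n, I (jet d (u n) x₀) = I (jet d (u (n + 1)) x₀)

/-- `J(u_n, u_{n+1}, …, u_{n+d})` is an `x`-integral of order `d`: it is smooth, really depends
on `u_n` and on `u_{n+d}`, and on solutions its total derivative with respect to `x` vanishes. -/
structure IsXIntegral {r : ℕ} (K : Matrix (Fin r) (Fin r) ℝ) (d : ℕ)
    (J : (Fin (d + 1) → Fin r → ℝ) → ℝ) : Prop where
  smooth : ContDiff ℝ ∞ J
  depends_first : ∃ p j, partialAt J 0 p j ≠ 0
  depends_last : ∃ p j, partialAt J (Fin.last d) p j ≠ 0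
  invariant : ∀ (u : ℤ → ℝ → Fin r → ℝ) (x₀ : ℝ), IsExpSolution K u x₀ →
    ∀ n : ℤ, HasDerivAt (fun x => J fun i => u (n + (i : ℕ)) x) 0 x₀

/-- Essential independence of a family of functions of orders `d_1, …, d_k`: the matrix whose
`i`-th row consists of the partial derivatives of the `i`-th function with respect to the
variables of its highest order `d_i` has rank `k` (at every point). -/
def EssentiallyIndependent {r k : ℕ} (d : Fin k → ℕ)
    (F : ∀ i, (Fin (d i + 1) → Fin r → ℝ) → ℝ) : Prop :=
  ∀ p : ℕ → Fin r → ℝ,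
    (Matrix.of fun (i : Fin k) (j : Fin r) => partialAt (F i) (Fin.last (d i)) p j).rank = k

/-- Darboux integrability: there are `r` essentially independent `n`-integrals and `r`
essentially independent `x`-integrals, `r` being the number of unknown functions. -/
def DarbouxIntegrable {r : ℕ} (K : Matrix (Fin r) (Fin r) ℝ) : Prop :=
  (∃ (d : Fin r → ℕ) (I : ∀ i, (Fin (d i + 1) → Fin r → ℝ) → ℝ),
    (∀ i, IsNIntegral K (d i) (I i)) ∧ EssentiallyIndependent d I) ∧
  (∃ (d : Fin r → ℕ) (J : ∀ i, (Fin (d i + 1) → Fin r → ℝ) → ℝ),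
    (∀ i, IsXIntegral K (d i) (J i)) ∧ EssentiallyIndependent d J)

/-! ### The lattice of the series `A` -/

/-- The Laplace invariants `h_n(j) = exp (q_{n+1}(j+1) - q_n(j))` of the lattice with sites
`lo ≤ j ≤ hi`; the trivial boundary conditions are `h_n(lo-1) = h_n(hi) = 0`. -/
def laplaceInv (lo hi : ℤ) (q : ℤ → ℤ → ℝ → ℝ) (n j : ℤ) (x : ℝ) : ℝ :=
  if lo ≤ j ∧ j < hi then Real.exp (q (n + 1) (j + 1) x - q n j x) else 0

/-- `q` is a smooth solution near `x₀` of the semidiscrete Toda lattice of the series `A` with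
sites `lo ≤ j ≤ hi`: `q_{n,x}(j) - q_{n+1,x}(j) = h_n(j) - h_n(j-1)`. -/
def IsASolution (lo hi : ℤ) (q : ℤ → ℤ → ℝ → ℝ) (x₀ : ℝ) : Prop :=
  (∀ n j, lo ≤ j → j ≤ hi → ∀ᶠ x in 𝓝 x₀, ContDiffAt ℝ ∞ (q n j) x) ∧
  ∀ n j, lo ≤ j → j ≤ hi → ∀ᶠ x in 𝓝 x₀,
    deriv (q n j) x - deriv (q (n + 1) j) x
      = laplaceInv lo hi q n j x - laplaceInv lo hi q n (j - 1) x

/-- The coefficient functions of the product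
`(∂ - q_{n,x}(lo+m-1)) ⋯ (∂ - q_{n,x}(lo+1)) (∂ - q_{n,x}(lo))` of `m` factors, where `∂ = d/dx`:
`diffCoeff q lo n m k x` is the coefficient of `∂^k` at `x`. -/
def diffCoeff (q : ℤ → ℤ → ℝ → ℝ) (lo n : ℤ) : ℕ → ℕ → ℝ → ℝ
  | 0, 0 => fun _ => 1
  | 0, _ + 1 => fun _ => 0
  | m + 1, 0 => fun x =>
      deriv (diffCoeff q lo n m 0) x - deriv (q n (lo + m)) x * diffCoeff q lo n m 0 x
  | m + 1, k + 1 => fun x =>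
      deriv (diffCoeff q lo n m (k + 1)) x - deriv (q n (lo + m)) x * diffCoeff q lo n m (k + 1) x
        + diffCoeff q lo n m k x

/-- The coefficient functions of the product
`(T + g_n(hi-m+1)) ⋯ (T + g_n(hi-1)) (T + g_n(hi))` of `m` factors, where `T` is the shift
`n ↦ n + 1` and `g_n(j) = exp (q_n(j) - q_{n+1}(j))`:
`shiftCoeff q hi m k n x` is the coefficient of `T^k` at `(n, x)`. -/
def shiftCoeff (q : ℤ → ℤ → ℝ → ℝ) (hi : ℤ) : ℕ → ℕ → ℤ → ℝ → ℝ
  | 0, 0 => fun _ _ => 1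
  | 0, _ + 1 => fun _ _ => 0
  | m + 1, 0 => fun n x =>
      Real.exp (q n (hi - m) x - q (n + 1) (hi - m) x) * shiftCoeff q hi m 0 n x
  | m + 1, k + 1 => fun n x =>
      Real.exp (q n (hi - m) x - q (n + 1) (hi - m) x) * shiftCoeff q hi m (k + 1) n x
        + shiftCoeff q hi m k (n + 1) x

/-! ### The reduction -/

/-- The extension of `u_n(0), …, u_n(r-1)` to all `j ∈ ℤ` by the reflection
`u_n(-j) = u_{n+j}(j)` for `0 ≤ j < r` and by `0` for `|j| ≥ r`. -/
def reflectExt {r : ℕ} (u : ℤ → ℝ → Fin r → ℝ) (n j : ℤ) (x : ℝ) : ℝ :=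
  if h : j.natAbs < r then u (n + max (-j) 0) x ⟨j.natAbs, h⟩ else 0

/-- The variables `q_n(j) = u_n(j) - u_n(j-1)`, where `-r+1 ≤ j ≤ r`, of the lattice of the
series `A` of double length, expressed through the unknowns of the lattice of the series `C`. -/
def reduced {r : ℕ} (u : ℤ → ℝ → Fin r → ℝ) : ℤ → ℤ → ℝ → ℝ :=
  fun n j x => reflectExt u n j x - reflectExt u n (j - 1) x

end SemidiscreteToda

end

/-!
The coefficients of the two products are integrals because the lattice of the series `A` is the
compatibility condition of Darboux transformations of factorized operators. For
`P_m = (∂ - q_{n,x}(lo+m-1)) ⋯ (∂ - q_{n,x}(lo))`, and `Q_m` the same product for `n + 1`, the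
equations give `Q_{m+1} = P_{m+1} + h_n(lo+m) P_m` (`opCoeff_darboux`), and `h_n` vanishes at the
right end. Similarly, the `x`-derivative of the product of the `m + 1` rightmost factors
`T + g_n(j)` is `-g_n(j) h_n(j-1)` times the product of the `m` rightmost ones
(`IsASolution.hasDerivAt_shiftCoeff`), and `h_n` vanishes at the left end.

With `u_n(-j) = u_{n+j}(j)` the exponents of the lattice of the series `C` are
`q_{n+1}(j+1) - q_n(j)`, and its equations at `j` and at `-j` coincide up to a shift of `n`; this
gives the reduction.

The reduced differential operator contains the shifted functions `u_{n+j}(j)`. They are eliminated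
by applying the Darboux transformation again, to the right half of the product: on solutions the
reduced operator is equal to `(∂ - v_r) ⋯ (∂ - v_1) (∂ + v_1) ⋯ (∂ + v_r)`, where
`v_j = u_{n,x}(j) - u_{n,x}(j-1)` and `u_n(r) = 0` (`IsExpSolution.opCoeff_reduced`,
`IsExpSolution.diffCoeff_reduced`). The coefficients of this product are differential polynomials.
The coefficient of `∂^k` is linear in the derivatives of the highest order `2r - k`, and for
`k < r` these leading parts form an antitriangular matrix with constant entries
(`exists_hasLeading_opCoeff`). The coefficients of `∂^0, …, ∂^{r-1}` are therefore essentially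
independent.

For the shift operator, put `G_n(j) = exp (u_n(j) - u_{n+1}(j))`, so that
`exp (q_n(j) - q_{n+1}(j)) = G_n(j) / G_n(j-1)`. By telescoping, the coefficient of `T^k` is the
sum over `-r ≤ j_1 < ⋯ < j_k < r` of the products of `G_{n+i-1}(j_i) / G_{n+i}(j_i+1)`,
`1 ≤ i ≤ k` (`shiftCoeff_reduced`). For `1 ≤ k ≤ r` this sum really depends on `u_n` and on
`u_{n+r+1}`, and only on `u_n, …, u_{n+r+1}`, whereas for `k > r` it does not depend on `u_n`, and
for `k = 0` it is 1. This dictates the choice of the coefficients of `T^1, …, T^r`. The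
coordinates of `u_{n+r+1}` on which the coefficient of `T^k` depends are those with `j ≥ r - k`,
and the derivative at `j = r - k` is positive (`exists_weightSum_bump_last`), so that the matrix
of derivatives is again antitriangular.
-/

noncomputable section

namespace SemidiscreteToda

/-! ### Functions smooth near a point -/

/-- `f` is smooth on a neighbourhood of `x₀`. This is stronger than `ContDiffAt ℝ ∞ f x₀`, which
allows the neighbourhood to shrink with the order of differentiability. -/
def SmoothNear {E : Type*} [NormedAddCommGroup E] [NormedSpace ℝ E] (f : ℝ → E) (x₀ : ℝ) : Prop :=
  ∀ᶠ x in 𝓝 x₀, ContDiffAt ℝ ∞ f x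

namespace SmoothNear

variable {f g : ℝ → ℝ} {x₀ : ℝ}

theorem const (c : ℝ) : SmoothNear (fun _ => c) x₀ :=
  Filter.Eventually.of_forall fun _ => contDiffAt_const

theorem add (hf : SmoothNear f x₀) (hg : SmoothNear g x₀) :
    SmoothNear (fun x => f x + g x) x₀ :=
  (hf.and hg).mono fun _ h => h.1.add h.2

theorem sub (hf : SmoothNear f x₀) (hg : SmoothNear g x₀) :
    SmoothNear (fun x => f x - g x) x₀ :=
  (hf.and hg).mono fun _ h => h.1.sub h.2

theorem mul (hf : SmoothNear f x₀) (hg : SmoothNear g x₀) :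
    SmoothNear (fun x => f x * g x) x₀ :=
  (hf.and hg).mono fun _ h => h.1.mul h.2

theorem exp (hf : SmoothNear f x₀) : SmoothNear (fun x => Real.exp (f x)) x₀ :=
  hf.mono fun _ h => h.exp

theorem deriv {E : Type*} [NormedAddCommGroup E] [NormedSpace ℝ E] {f : ℝ → E}
    (hf : SmoothNear f x₀) : SmoothNear (deriv f) x₀ :=
  hf.mono fun x hx => hx.derivWithin (by simp)

theorem differentiable {E : Type*} [NormedAddCommGroup E] [NormedSpace ℝ E] {f : ℝ → E}
    (hf : SmoothNear f x₀) : ∀ᶠ x in 𝓝 x₀, DifferentiableAt ℝ f x :=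
  hf.mono fun _ h => h.differentiableAt (by simp)

end SmoothNear

/-! ### Products of first order differential operators -/

/-- Let `A` be a commutative ring with an operation `D`, in the applications a derivation.
`opCoeff D a m k` is the coefficient of `∂^k` in the product
`(∂ - a (m-1)) ⋯ (∂ - a 1) (∂ - a 0)`, where `∂ f = D f + f ∂`. -/
def opCoeff {A : Type*} [CommRing A] (D : A → A) (a : ℕ → A) : ℕ → ℕ → A
  | 0, 0 => 1
  | 0, _ + 1 => 0
  | m + 1, 0 => D (opCoeff D a m 0) - a m * opCoeff D a m 0
  | m + 1, k + 1 => D (opCoeff D a m (k + 1)) - a m * opCoeff D a m (k + 1) + opCoeff D a m k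

theorem diffCoeff_eq_opCoeff (q : ℤ → ℤ → ℝ → ℝ) (lo n : ℤ) (m k : ℕ) :
    diffCoeff q lo n m k = opCoeff deriv (fun i => deriv (q n (lo + i))) m k := by
  induction m generalizing k with
  | zero => cases k <;> rfl
  | succ m ih => cases k <;> (funext x; simp [diffCoeff, opCoeff, ih])

theorem smoothNear_opCoeff {a : ℕ → ℝ → ℝ} {x₀ : ℝ} {m : ℕ}
    (ha : ∀ i < m, SmoothNear (a i) x₀) (k : ℕ) : SmoothNear (opCoeff deriv a m k) x₀ := by
  induction m generalizing k with
  | zero => cases k <;> exact SmoothNear.const _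
  | succ m ih =>
    have ih' := ih fun i hi => ha i (hi.trans (Nat.lt_succ_self m))
    cases k with
    | zero => exact (ih' 0).deriv.sub ((ha m (Nat.lt_succ_self m)).mul (ih' 0))
    | succ k =>
      exact ((ih' _).deriv.sub ((ha m (Nat.lt_succ_self m)).mul (ih' _))).add (ih' k)

theorem opCoeff_congr {a b : ℕ → ℝ → ℝ} {x₀ : ℝ} {m₀ m : ℕ} (hm : m₀ ≤ m)
    (h₀ : ∀ k, opCoeff deriv a m₀ k =ᶠ[𝓝 x₀] opCoeff deriv b m₀ k)
    (h : ∀ i, m₀ ≤ i → i < m → a i =ᶠ[𝓝 x₀] b i) (k : ℕ) :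
    opCoeff deriv a m k =ᶠ[𝓝 x₀] opCoeff deriv b m k := by
  induction m, hm using Nat.le_induction generalizing k with
  | base => exact h₀ k
  | succ m hm ih =>
    have ih' := ih fun i h₁ h₂ => h i h₁ (h₂.trans (Nat.lt_succ_self m))
    have h' := h m hm (Nat.lt_succ_self m)
    cases k with
    | zero => exact (ih' 0).deriv.sub (h'.mul (ih' 0))
    | succ k => exact ((ih' _).deriv.sub (h'.mul (ih' _))).add (ih' k)

/-- The Darboux transformation of a product of first order operators. If the functions `a i`, `b i`
satisfy `a i - b i = h i - h (i-1)` (with `h (-1) = 0`) and `h i' = h i (b (i+1) - a i)`, then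
`∏_{i ≤ m} (∂ - b i) = ∏_{i ≤ m} (∂ - a i) + h m ∏_{i < m} (∂ - a i)`. -/
theorem opCoeff_darboux {a b h : ℕ → ℝ → ℝ} {x₀ : ℝ} {m : ℕ}
    (ha : ∀ i ≤ m, SmoothNear (a i) x₀) (hh : ∀ i < m, SmoothNear (h i) x₀)
    (h_zero : ∀ᶠ x in 𝓝 x₀, a 0 x - b 0 x = h 0 x)
    (h_succ : ∀ i < m, ∀ᶠ x in 𝓝 x₀, a (i + 1) x - b (i + 1) x = h (i + 1) x - h i x)
    (h_deriv : ∀ i < m, ∀ᶠ x in 𝓝 x₀, deriv (h i) x = h i x * (b (i + 1) x - a i x)) (k : ℕ) :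
    opCoeff deriv b (m + 1) k =ᶠ[𝓝 x₀]
      fun x => opCoeff deriv a (m + 1) k x + h m x * opCoeff deriv a m k x := by
  induction m generalizing k with
  | zero =>
    filter_upwards [h_zero] with x hx
    match k with
    | 0 => simp [opCoeff]; linarith
    | 1 => simp [opCoeff]
    | k + 2 => simp [opCoeff]
  | succ m ih =>
    have ih' := ih (fun i hi => ha i (by omega)) (fun i hi => hh i (by omega))
      (fun i hi => h_succ i (by omega)) (fun i hi => h_deriv i (by omega))
    have hd : ∀ k, ∀ᶠ x in 𝓝 x₀, deriv (opCoeff deriv b (m + 1) k) x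
        = deriv (opCoeff deriv a (m + 1) k) x + (deriv (h m) x * opCoeff deriv a m k x
          + h m x * deriv (opCoeff deriv a m k) x) := by
      intro k
      filter_upwards [(ih' k).deriv, (hh m (by omega)).differentiable,
        (smoothNear_opCoeff (m := m) (fun i hi => ha i (by omega)) k).differentiable,
        (smoothNear_opCoeff (m := m + 1) (fun i hi => ha i (by omega)) k).differentiable]
        with x hx h1 h2 h3
      rw [hx]
      exact (h3.hasDerivAt.add (h1.hasDerivAt.mul h2.hasDerivAt)).deriv
    cases k with
    | zero =>
      filter_upwards [ih' 0, hd 0, h_succ m (by omega), h_deriv m (by omega)] with x e1 e2 e3 e4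
      have ea : opCoeff deriv a (m + 1) 0 x
        = deriv (opCoeff deriv a m 0) x - a m x * opCoeff deriv a m 0 x := rfl
      have ea' : opCoeff deriv a (m + 2) 0 x = deriv (opCoeff deriv a (m + 1) 0) x
        - a (m + 1) x * opCoeff deriv a (m + 1) 0 x := rfl
      have eb : opCoeff deriv b (m + 2) 0 x = deriv (opCoeff deriv b (m + 1) 0) x
        - b (m + 1) x * opCoeff deriv b (m + 1) 0 x := rfl
      have e3' : b (m + 1) x = a (m + 1) x - h (m + 1) x + h m x := by linarith
      rw [eb, ea', e2, e1, e4, e3']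
      linear_combination (-h m x) * ea
    | succ k =>
      filter_upwards [ih' (k + 1), ih' k, hd (k + 1), h_succ m (by omega), h_deriv m (by omega)]
        with x e1 e1' e2 e3 e4
      have ea : opCoeff deriv a (m + 1) (k + 1) x = deriv (opCoeff deriv a m (k + 1)) x
        - a m x * opCoeff deriv a m (k + 1) x + opCoeff deriv a m k x := rfl
      have ea' : opCoeff deriv a (m + 2) (k + 1) x = deriv (opCoeff deriv a (m + 1) (k + 1)) x
        - a (m + 1) x * opCoeff deriv a (m + 1) (k + 1) x + opCoeff deriv a (m + 1) k x := rfl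
      have eb : opCoeff deriv b (m + 2) (k + 1) x = deriv (opCoeff deriv b (m + 1) (k + 1)) x
        - b (m + 1) x * opCoeff deriv b (m + 1) (k + 1) x + opCoeff deriv b (m + 1) k x := rfl
      have e3' : b (m + 1) x = a (m + 1) x - h (m + 1) x + h m x := by linarith
      rw [eb, ea', e2, e1, e1', e4, e3']
      linear_combination (-h m x) * ea

/-! ### Integrals of the lattice of the series `A` -/

section SeriesA

variable {lo hi : ℤ} {q : ℤ → ℤ → ℝ → ℝ} {x₀ : ℝ}

theorem laplaceInv_of_mem {j : ℤ} (h₁ : lo ≤ j) (h₂ : j < hi) (n : ℤ) (x : ℝ) :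
    laplaceInv lo hi q n j x = Real.exp (q (n + 1) (j + 1) x - q n j x) :=
  if_pos ⟨h₁, h₂⟩

theorem laplaceInv_of_lt {j : ℤ} (h : j < lo) (n : ℤ) (x : ℝ) : laplaceInv lo hi q n j x = 0 :=
  if_neg fun h' => by omega

theorem laplaceInv_of_ge {j : ℤ} (h : hi ≤ j) (n : ℤ) (x : ℝ) : laplaceInv lo hi q n j x = 0 :=
  if_neg fun h' => by omega

theorem IsASolution.smoothNear_laplaceInv (hq : IsASolution lo hi q x₀) {j : ℤ}
    (n : ℤ) : SmoothNear (laplaceInv lo hi q n j) x₀ := by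
  by_cases h : lo ≤ j ∧ j < hi
  · have : laplaceInv lo hi q n j = fun x => Real.exp (q (n + 1) (j + 1) x - q n j x) :=
      funext (laplaceInv_of_mem h.1 h.2 n)
    rw [this]
    exact SmoothNear.exp (SmoothNear.sub (hq.1 _ _ (by omega) (by omega))
      (hq.1 _ _ (by omega) (by omega)))
  · have : laplaceInv lo hi q n j = fun _ => 0 := funext fun x => if_neg h
    rw [this]
    exact SmoothNear.const 0

theorem IsASolution.diffCoeff_succ (hq : IsASolution lo hi q x₀) {m : ℕ} (hm : hi = lo + m)
    (n : ℤ) (k : ℕ) :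
    diffCoeff q lo n (m + 1) k x₀ = diffCoeff q lo (n + 1) (m + 1) k x₀ := by
  have key := opCoeff_darboux (x₀ := x₀) (m := m) (a := fun i => deriv (q n (lo + i)))
    (b := fun i => deriv (q (n + 1) (lo + i))) (h := fun i => laplaceInv lo hi q n (lo + i))
    (fun i hi' => SmoothNear.deriv (hq.1 _ _ (by omega) (by omega)))
    (fun i hi' => hq.smoothNear_laplaceInv n)
    (by
      filter_upwards [hq.2 n lo le_rfl (by omega)] with x hx
      rw [laplaceInv_of_lt (j := lo - 1) (by omega)] at hx
      simpa using hx)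
    (fun i hi' => by
      filter_upwards [hq.2 n (lo + (i + 1 : ℕ)) (by omega) (by omega)] with x hx
      rw [hx]
      congr 2
      push_cast; ring)
    (fun i hi' => by
      filter_upwards [SmoothNear.differentiable (hq.1 (n + 1) (lo + (i + 1 : ℕ)) (by omega)
        (by omega)), SmoothNear.differentiable (hq.1 n (lo + i) (by omega) (by omega))]
        with x h1 h2
      have e : laplaceInv lo hi q n (lo + i)
          = fun x => Real.exp (q (n + 1) (lo + (i + 1 : ℕ)) x - q n (lo + i) x) := by
        funext y
        rw [laplaceInv_of_mem (by omega) (by omega)]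
        push_cast; ring_nf
      rw [e]
      exact (h1.hasDerivAt.sub h2.hasDerivAt).exp.deriv) k
  rw [diffCoeff_eq_opCoeff, diffCoeff_eq_opCoeff, key.self_of_nhds]
  simp only [laplaceInv_of_ge hm.le]
  ring

/-- The `x`-derivative of the partial product of the `m + 1` rightmost shift operators is a
multiple of the previous partial product, with the factor `-g_n(j) h_n(j-1)`, `j = hi - m`, which
vanishes at the left end of the lattice. -/
theorem IsASolution.hasDerivAt_shiftCoeff (hq : IsASolution lo hi q x₀) {m : ℕ}
    (hm : lo + m ≤ hi) (k : ℕ) (n : ℤ) :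
    HasDerivAt (shiftCoeff q hi (m + 1) k n)
      (-(Real.exp (q n (hi - m) x₀ - q (n + 1) (hi - m) x₀)
        * laplaceInv lo hi q n (hi - m - 1) x₀ * shiftCoeff q hi m k n x₀)) x₀ := by
  have hg : ∀ (n j : ℤ), lo ≤ j → j ≤ hi →
      HasDerivAt (fun x => Real.exp (q n j x - q (n + 1) j x))
        (Real.exp (q n j x₀ - q (n + 1) j x₀)
          * (laplaceInv lo hi q n j x₀ - laplaceInv lo hi q n (j - 1) x₀)) x₀ := by
    intro n j h1 h2
    rw [← (hq.2 n j h1 h2).self_of_nhds]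
    exact ((SmoothNear.differentiable (hq.1 n j h1 h2)).self_of_nhds.hasDerivAt.sub
      (SmoothNear.differentiable (hq.1 (n + 1) j h1 h2)).self_of_nhds.hasDerivAt).exp
  induction m generalizing k n with
  | zero =>
    have h := hg n (hi - (0 : ℕ)) (by omega) (by omega)
    rw [laplaceInv_of_ge (j := hi - (0 : ℕ)) (by omega)] at h
    match k with
    | 0 =>
      convert h using 1
      · funext x; simp [shiftCoeff]
      · simp [shiftCoeff]
    | 1 => simpa [shiftCoeff] using! hasDerivAt_const x₀ (1 : ℝ)
    | k + 2 => simpa [shiftCoeff] using! hasDerivAt_const x₀ (0 : ℝ)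
  | succ m ih =>
    have ih' := ih (by push_cast at hm; omega)
    have h := hg n (hi - (m + 1 : ℕ)) (by omega) (by omega)
    -- the two relations `g_n(j) h_n(j) = c_{n+1}(j+1)` and
    -- `g_n(j) c_n(j+1) = c_{n+1}(j+1) g_n(j+1)`, where `c_n(j) = g_n(j) h_n(j-1)`
    have r : ∀ n : ℤ, laplaceInv lo hi q n (hi - m - 1) x₀
        = Real.exp (q (n + 1) (hi - m) x₀ - q n (hi - (m + 1 : ℕ)) x₀) := by
      intro n
      rw [laplaceInv_of_mem (by push_cast at hm; omega) (by omega)]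
      push_cast; ring_nf
    have r' : laplaceInv lo hi q n (hi - (m + 1 : ℕ)) x₀
        = Real.exp (q (n + 1) (hi - m) x₀ - q n (hi - (m + 1 : ℕ)) x₀) := by
      rw [← r]; congr 1; push_cast; ring
    set j : ℤ := hi - (m + 1 : ℕ) with hj
    have r₁ : Real.exp (q n j x₀ - q (n + 1) j x₀) * laplaceInv lo hi q n j x₀
        = Real.exp (q (n + 1) (hi - m) x₀ - q (n + 1 + 1) (hi - m) x₀)
          * laplaceInv lo hi q (n + 1) (hi - m - 1) x₀ := by
      rw [r, r', ← Real.exp_add, ← Real.exp_add]; congr 1; ring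
    have r₂ : Real.exp (q n j x₀ - q (n + 1) j x₀) *
          (Real.exp (q n (hi - m) x₀ - q (n + 1) (hi - m) x₀)
            * laplaceInv lo hi q n (hi - m - 1) x₀)
        = Real.exp (q (n + 1) (hi - m) x₀ - q (n + 1 + 1) (hi - m) x₀)
          * laplaceInv lo hi q (n + 1) (hi - m - 1) x₀
          * Real.exp (q n (hi - m) x₀ - q (n + 1) (hi - m) x₀) := by
      rw [r, r]; simp only [← Real.exp_add]; congr 1; ring
    cases k with
    | zero =>
      have e : shiftCoeff q hi (m + 1) 0 n x₀
        = Real.exp (q n (hi - m) x₀ - q (n + 1) (hi - m) x₀) * shiftCoeff q hi m 0 n x₀ := rfl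
      refine (h.mul (ih' 0 n)).congr_deriv ?_
      linear_combination shiftCoeff q hi (m + 1) 0 n x₀ * r₁ - shiftCoeff q hi m 0 n x₀ * r₂
        + Real.exp (q (n + 1) (hi - m) x₀ - q (n + 1 + 1) (hi - m) x₀)
          * laplaceInv lo hi q (n + 1) (hi - m - 1) x₀ * e
    | succ k =>
      have e : shiftCoeff q hi (m + 1) (k + 1) n x₀
        = Real.exp (q n (hi - m) x₀ - q (n + 1) (hi - m) x₀) * shiftCoeff q hi m (k + 1) n x₀
          + shiftCoeff q hi m k (n + 1) x₀ := rfl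
      refine ((h.mul (ih' (k + 1) n)).add (ih' k (n + 1))).congr_deriv ?_
      linear_combination shiftCoeff q hi (m + 1) (k + 1) n x₀ * r₁
        - shiftCoeff q hi m (k + 1) n x₀ * r₂
        + Real.exp (q (n + 1) (hi - m) x₀ - q (n + 1 + 1) (hi - m) x₀)
          * laplaceInv lo hi q (n + 1) (hi - m - 1) x₀ * e

theorem IsASolution.hasDerivAt_shiftCoeff_zero (hq : IsASolution lo hi q x₀) {m : ℕ}
    (hm : hi = lo + m) (k : ℕ) (n : ℤ) : HasDerivAt (shiftCoeff q hi (m + 1) k n) 0 x₀ := by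
  refine (hq.hasDerivAt_shiftCoeff hm.ge k n).congr_deriv ?_
  rw [laplaceInv_of_lt (by omega)]
  ring

end SeriesA

/-! ### The reduction of the lattice of the series `A` to the series `C` -/

section Reduction

variable {r : ℕ} {u : ℤ → ℝ → Fin r → ℝ} {x₀ : ℝ}

theorem reflectExt_coe (u : ℤ → ℝ → Fin r → ℝ) (n : ℤ) (c : Fin r) (x : ℝ) :
    reflectExt u n c x = u n x c := by
  simp [reflectExt]

theorem reflectExt_of_le {j : ℤ} (h : r ≤ j.natAbs) (n : ℤ) : reflectExt u n j = fun _ => 0 :=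
  funext fun _ => dif_neg (by omega)

theorem reflectExt_of_nonneg {j : ℤ} (h₀ : 0 ≤ j) (h : j < r) (n : ℤ) :
    reflectExt u n j = fun x => u n x ⟨j.toNat, by omega⟩ := by
  funext x
  rw [← reflectExt_coe u n]
  simp [Int.toNat_of_nonneg h₀]

theorem reflectExt_neg (u : ℤ → ℝ → Fin r → ℝ) (n j : ℤ) :
    reflectExt u n (-j) = reflectExt u (n + j) j := by
  funext x
  have h : n + max j 0 = n + j + max (-j) 0 := by omega
  simp [reflectExt, h]

theorem reduced_sub_reduced (u : ℤ → ℝ → Fin r → ℝ) (n j : ℤ) (x : ℝ) :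
    reduced u (n + 1) (j + 1) x - reduced u n j x
      = reflectExt u (n + 1) (j + 1) x - reflectExt u (n + 1) j x
        - reflectExt u n j x + reflectExt u n (j - 1) x := by
  simp only [reduced, add_sub_cancel_right]
  ring

theorem laplaceInv_reduced_neg (u : ℤ → ℝ → Fin r → ℝ) (n j : ℤ) (x : ℝ) :
    laplaceInv (1 - (r : ℤ)) r (reduced u) n (-j) x
      = laplaceInv (1 - (r : ℤ)) r (reduced u) (n + j) j x := by
  by_cases h : 1 - (r : ℤ) ≤ j ∧ j < r
  · rw [laplaceInv_of_mem (by omega) (by omega), laplaceInv_of_mem h.1 h.2, reduced_sub_reduced,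
      reduced_sub_reduced, show -j + 1 = -(j - 1) by ring, show -j - 1 = -(j + 1) by ring]
    simp only [reflectExt_neg]
    rw [show n + 1 + (j - 1) = n + j by ring, show n + 1 + j = n + j + 1 by ring,
      show n + (j + 1) = n + j + 1 by ring]
    congr 1
    ring
  · rw [laplaceInv, laplaceInv, if_neg h, if_neg (by omega)]

theorem cMatrix_apply (j k : Fin r) :
    cMatrix r j k = if j = k then -2 else if (k : ℕ) + 1 = j then 1
      else if (j : ℕ) + 1 = k then (if (j : ℕ) = 0 then 2 else 1) else 0 := by
  have hj := j.isLt
  have hk := k.isLt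
  simp only [cMatrix, CartanMatrix.C, Matrix.of_apply, Fin.ext_iff, Fin.val_rev]
  split_ifs <;> first | omega | norm_num

theorem exponent_cMatrix (u : ℤ → ℝ → Fin r → ℝ) (n : ℤ) (c : Fin r) (x : ℝ) :
    exponent (cMatrix r) (u n x) (u (n + 1) x) c
      = reduced u (n + 1) (c + 1) x - reduced u n c x := by
  have hdiag : cMatrix r c c = -2 := by simp [cMatrix_apply]
  have hIoi : ∑ k ∈ Finset.Ioi c, cMatrix r c k * u (n + 1) x k
      = (if (c : ℕ) = 0 then 2 else 1) * reflectExt u (n + 1) (c + 1) x := by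
    by_cases h : (c : ℕ) + 1 < r
    · have e : reflectExt u (n + 1) (c + 1) x = u (n + 1) x ⟨c + 1, h⟩ :=
        reflectExt_coe u (n + 1) ⟨c + 1, h⟩ x
      rw [e, Finset.sum_eq_single_of_mem ⟨c + 1, h⟩ (by simp [Fin.lt_def])]
      · simp [cMatrix_apply, Fin.ext_iff]
        omega
      · intro k hk hne
        have hk' : (c : ℕ) < k := Fin.lt_def.1 (Finset.mem_Ioi.1 hk)
        have hne' : (k : ℕ) ≠ c + 1 := fun h' => hne (Fin.ext h')
        rw [cMatrix_apply, if_neg (by omega), if_neg (by omega), if_neg (by omega), zero_mul]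
    · rw [reflectExt_of_le (by omega), Finset.sum_eq_zero]
      · simp
      · intro k hk
        have hk' : (c : ℕ) < k := Fin.lt_def.1 (Finset.mem_Ioi.1 hk)
        omega
  have hIio : ∑ k ∈ Finset.Iio c, cMatrix r c k * u n x k
      = if (c : ℕ) = 0 then 0 else reflectExt u n (c - 1) x := by
    split_ifs with h
    · refine Finset.sum_eq_zero fun k hk => ?_
      have hk' : (k : ℕ) < c := Fin.lt_def.1 (Finset.mem_Iio.1 hk)
      omega
    · have e : reflectExt u n (c - 1) x = u n x ⟨c - 1, by omega⟩ := by
        have := reflectExt_coe u n ⟨(c : ℕ) - 1, by omega⟩ x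
        rwa [Nat.cast_pred (by omega)] at this
      rw [e, Finset.sum_eq_single_of_mem ⟨c - 1, by omega⟩
        (by simp only [Finset.mem_Iio, Fin.lt_def]; omega)]
      · rw [cMatrix_apply, if_neg (by simp only [Fin.ext_iff]; omega),
          if_pos (by simp only; omega), one_mul]
      · intro k hk hne
        have hk' : (k : ℕ) < c := Fin.lt_def.1 (Finset.mem_Iio.1 hk)
        have hne' : (k : ℕ) ≠ c - 1 := fun h' => hne (Fin.ext h')
        rw [cMatrix_apply, if_neg (by omega), if_neg (by omega), if_neg (by omega), zero_mul]
  rw [exponent, hIoi, hIio, hdiag, reduced_sub_reduced, reflectExt_coe, reflectExt_coe]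
  by_cases h : (c : ℕ) = 0
  · -- at the long root `u_n(-1) = u_{n+1}(1)` doubles the coefficient of `u_{n+1}(1)`
    have e : reflectExt u n (c - 1) x = reflectExt u (n + 1) (c + 1) x := by
      rw [h]
      exact congrFun (reflectExt_neg u n 1) x
    rw [if_pos h, if_pos h, e]
    ring
  · rw [if_neg h, if_neg h]
    ring

theorem exp_exponent_cMatrix (u : ℤ → ℝ → Fin r → ℝ) (n : ℤ) (c : Fin r) (x : ℝ) :
    Real.exp (exponent (cMatrix r) (u n x) (u (n + 1) x) c)
      = laplaceInv (1 - (r : ℤ)) r (reduced u) n c x := by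
  rw [laplaceInv_of_mem (by omega) (by omega), exponent_cMatrix]

namespace IsExpSolution

variable {K : Matrix (Fin r) (Fin r) ℝ}

theorem smoothNear_coord (hu : IsExpSolution K u x₀) (n : ℤ) (c : Fin r) :
    SmoothNear (fun x => u n x c) x₀ :=
  (hu.1 n).mono fun _ hx => contDiffAt_pi.1 hx c

theorem smoothNear_reflectExt (hu : IsExpSolution K u x₀) (n j : ℤ) :
    SmoothNear (reflectExt u n j) x₀ := by
  have pos : ∀ n j : ℤ, 0 ≤ j → SmoothNear (reflectExt u n j) x₀ := by
    intro n j h₀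
    by_cases h : j < r
    · rw [reflectExt_of_nonneg h₀ h]
      exact hu.smoothNear_coord n _
    · rw [reflectExt_of_le (by omega)]
      exact SmoothNear.const 0
  rcases le_total 0 j with h | h
  · exact pos n j h
  · obtain ⟨i, rfl⟩ : ∃ i, j = -i := ⟨-j, by ring⟩
    rw [reflectExt_neg]
    exact pos _ _ (by omega)

theorem smoothNear_reduced (hu : IsExpSolution K u x₀) (n j : ℤ) :
    SmoothNear (reduced u n j) x₀ :=
  (hu.smoothNear_reflectExt n j).sub (hu.smoothNear_reflectExt n (j - 1))

theorem deriv_reduced (hu : IsExpSolution K u x₀) (n j : ℤ) :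
    ∀ᶠ x in 𝓝 x₀, deriv (reduced u n j) x
      = deriv (reflectExt u n j) x - deriv (reflectExt u n (j - 1)) x := by
  filter_upwards [(hu.smoothNear_reflectExt n j).differentiable,
    (hu.smoothNear_reflectExt n (j - 1)).differentiable] with x h₁ h₂
  exact (h₁.hasDerivAt.sub h₂.hasDerivAt).deriv

/-- The equations of the lattice of the series `C` hold for the reflected sequence at all sites. -/
theorem deriv_reflectExt_sub (hu : IsExpSolution (cMatrix r) u x₀) (n j : ℤ) :
    ∀ᶠ x in 𝓝 x₀, deriv (reflectExt u n j) x - deriv (reflectExt u (n + 1) j) x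
      = laplaceInv (1 - (r : ℤ)) r (reduced u) n j x := by
  have pos : ∀ n j : ℤ, 0 ≤ j → ∀ᶠ x in 𝓝 x₀,
      deriv (reflectExt u n j) x - deriv (reflectExt u (n + 1) j) x
        = laplaceInv (1 - (r : ℤ)) r (reduced u) n j x := by
    intro n j h₀
    by_cases h : j < r
    · filter_upwards [hu.2 n, SmoothNear.differentiable (hu.1 n),
        SmoothNear.differentiable (hu.1 (n + 1))] with x hx h₁ h₂
      have := hx ⟨j.toNat, by omega⟩
      rw [exp_exponent_cMatrix] at this
      rw [reflectExt_of_nonneg h₀ h, reflectExt_of_nonneg h₀ h,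
        (hasDerivAt_pi.1 h₁.hasDerivAt _).deriv, (hasDerivAt_pi.1 h₂.hasDerivAt _).deriv, this]
      simp [Int.toNat_of_nonneg h₀]
    · refine Filter.Eventually.of_forall fun x => ?_
      rw [reflectExt_of_le (by omega), reflectExt_of_le (by omega), laplaceInv_of_ge (by omega)]
      simp
  rcases le_total 0 j with h | h
  · exact pos n j h
  · obtain ⟨i, rfl⟩ : ∃ i, j = -i := ⟨-j, by ring⟩
    filter_upwards [pos (n + i) i (by omega)] with x hx
    rw [reflectExt_neg, reflectExt_neg, laplaceInv_reduced_neg, ← hx, add_right_comm]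

theorem isASolution (hu : IsExpSolution (cMatrix r) u x₀) :
    IsASolution (1 - (r : ℤ)) r (reduced u) x₀ := by
  refine ⟨fun n j _ _ => hu.smoothNear_reduced n j, fun n j _ _ => ?_⟩
  filter_upwards [hu.deriv_reflectExt_sub n j, hu.deriv_reflectExt_sub n (j - 1),
    hu.deriv_reduced n j, hu.deriv_reduced (n + 1) j] with x h₁ h₂ h₃ h₄
  rw [h₃, h₄, ← h₁, ← h₂]
  ring

end IsExpSolution

/-- Solutions of the reduced lattice of the series `A` come from the lattice of the series `C`: as
`u_n(-r) = 0`, the functions `u_n(j)` are recovered by summation of the `q_n(j)` from the left. -/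
theorem isExpSolution_of_isASolution (hq : IsASolution (1 - (r : ℤ)) r (reduced u) x₀) :
    IsExpSolution (cMatrix r) u x₀ := by
  have key : ∀ i : ℕ, i < 2 * r → ∀ n : ℤ, SmoothNear (reflectExt u n (-r + i)) x₀ ∧
      ∀ᶠ x in 𝓝 x₀,
        deriv (reflectExt u n (-r + i)) x - deriv (reflectExt u (n + 1) (-r + i)) x
          = laplaceInv (1 - (r : ℤ)) r (reduced u) n (-r + i) x := by
    intro i
    induction i with
    | zero =>
      intro _ n
      refine ⟨?_, Filter.Eventually.of_forall fun x => ?_⟩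
      · rw [reflectExt_of_le (by omega)]
        exact SmoothNear.const 0
      · rw [reflectExt_of_le (by omega), reflectExt_of_le (by omega), laplaceInv_of_lt (by omega)]
        simp
    | succ i ih =>
      intro hi n
      have e : (-r + (i + 1 : ℕ) : ℤ) - 1 = -r + i := by push_cast; ring
      have split : ∀ n : ℤ, reflectExt u n (-r + (i + 1 : ℕ)) =
          fun x => reduced u n (-r + (i + 1 : ℕ)) x + reflectExt u n (-r + i) x := by
        intro n
        funext x
        rw [reduced, e]
        ring
      have hr : ∀ n : ℤ, SmoothNear (reduced u n (-r + (i + 1 : ℕ))) x₀ :=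
        fun n => hq.1 n _ (by push_cast; omega) (by push_cast; omega)
      have hd : ∀ n : ℤ, ∀ᶠ x in 𝓝 x₀, deriv (reflectExt u n (-r + (i + 1 : ℕ))) x
          = deriv (reduced u n (-r + (i + 1 : ℕ))) x + deriv (reflectExt u n (-r + i)) x := by
        intro n
        filter_upwards [(hr n).differentiable, (ih (by omega) n).1.differentiable] with x h₁ h₂
        rw [split]
        exact (h₁.hasDerivAt.add h₂.hasDerivAt).deriv
      refine ⟨?_, ?_⟩
      · rw [split]
        exact (hr n).add (ih (by omega) n).1
      · filter_upwards [hd n, hd (n + 1), (ih (by omega) n).2,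
          hq.2 n (-r + (i + 1 : ℕ)) (by push_cast; omega) (by push_cast; omega)] with x h₁ h₂ h₃ h₄
        rw [h₁, h₂]
        rw [e] at h₄
        linear_combination h₃ + h₄
  have coord : ∀ (n : ℤ) (c : Fin r), reflectExt u n c = fun x => u n x c :=
    fun n c => funext fun x => reflectExt_coe u n c x
  have key' : ∀ (n : ℤ) (c : Fin r), SmoothNear (fun x => u n x c) x₀ ∧
      ∀ᶠ x in 𝓝 x₀, deriv (fun x => u n x c) x - deriv (fun x => u (n + 1) x c) x
        = laplaceInv (1 - (r : ℤ)) r (reduced u) n c x := by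
    intro n c
    have h := key (r + c) (by omega) n
    rw [show (-r + (r + c : ℕ) : ℤ) = c by push_cast; ring, coord, coord] at h
    exact h
  have smooth : ∀ n, SmoothNear (u n) x₀ := fun n =>
    (Filter.eventually_all.2 fun c => (key' n c).1).mono fun x hx => contDiffAt_pi.2 hx
  refine ⟨smooth, fun n => ?_⟩
  filter_upwards [Filter.eventually_all.2 fun c => (key' n c).2, (smooth n).differentiable,
    (smooth (n + 1)).differentiable] with x hx h₁ h₂ c
  rw [exp_exponent_cMatrix, ← hx c, (hasDerivAt_pi.1 h₁.hasDerivAt c).deriv,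
    (hasDerivAt_pi.1 h₂.hasDerivAt c).deriv]

end Reduction

/-! ### Partial derivatives and ranks -/

/-- The unit vector in the direction of the `j`-th coordinate of `z_i` in the space of sequences
`(z_0, …, z_d)`. -/
abbrev coordVec {r d : ℕ} (i : Fin (d + 1)) (j : Fin r) : Fin (d + 1) → Fin r → ℝ :=
  Pi.single i (Pi.single j 1)

theorem partialAt_eq_of_hasDerivAt {r d : ℕ} {F : (Fin (d + 1) → Fin r → ℝ) → ℝ}
    (hF : ContDiff ℝ ∞ F) {i : Fin (d + 1)} {p : ℕ → Fin r → ℝ} {j : Fin r} {b : ℝ}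
    (h : HasDerivAt (fun t : ℝ => F ((fun l : Fin (d + 1) => p l) + t • coordVec i j)) b 0) :
    partialAt F i p j = b := by
  have hF' : HasFDerivAt F (fderiv ℝ F fun l => p l)
      ((fun l : Fin (d + 1) => p l) + (0 : ℝ) • coordVec i j) := by
    simpa using (hF.differentiable (by simp) fun l => p l).hasFDerivAt
  have hl : HasDerivAt (fun t : ℝ => (fun l : Fin (d + 1) => p l)
      + t • coordVec i j) (coordVec i j) 0 := by
    simpa using ((hasDerivAt_id (0 : ℝ)).smul_const (coordVec i j)).const_add
      fun l : Fin (d + 1) => p l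
  exact (hF'.comp_hasDerivAt (0 : ℝ) hl).unique h

theorem rank_eq_of_antitriangular {r : ℕ} {M : Matrix (Fin r) (Fin r) ℝ}
    (h₀ : ∀ i j : Fin r, (j : ℕ) + i + 1 < r → M i j = 0)
    (h₁ : ∀ i j : Fin r, (j : ℕ) + i + 1 = r → M i j ≠ 0) : M.rank = r := by
  rw [← Matrix.rank_submatrix M (Equiv.refl _) Fin.revPerm, Matrix.rank_of_det_ne_zero,
    Fintype.card_fin]
  rw [Matrix.det_of_isLowerTriangular]
  · exact Finset.prod_ne_zero_iff.2 fun i _ => h₁ _ _ (by simp; omega)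
  · intro i j hij
    have hij' : (i : ℕ) < j := hij
    exact h₀ _ _ (by simp; omega)

/-! ### Differential polynomials -/

section DifferentialPolynomials

open MvPolynomial

variable {r : ℕ}

/-- The total derivative of differential polynomials in `r` functions, where the variable `(i, j)`
stands for the `i`-th derivative of the `j`-th function. -/
def jetDeriv (r : ℕ) : Derivation ℝ (MvPolynomial (ℕ × Fin r) ℝ) (MvPolynomial (ℕ × Fin r) ℝ) :=
  mkDerivation ℝ fun s => X (s.1 + 1, s.2)

/-- The value of a differential polynomial at the function `f` and the point `x`. -/
def evalJet (f : ℝ → Fin r → ℝ) (x : ℝ) (P : MvPolynomial (ℕ × Fin r) ℝ) : ℝ :=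
  eval (fun s => iteratedDeriv s.1 f x s.2) P

/-- A differential polynomial as a function of the derivatives of orders `0, …, d`; the variables
of higher order are replaced by `0`. -/
def truncEval (d : ℕ) (P : MvPolynomial (ℕ × Fin r) ℝ) (z : Fin (d + 1) → Fin r → ℝ) : ℝ :=
  eval (fun s => if h : s.1 < d + 1 then z ⟨s.1, h⟩ s.2 else 0) P

/-- The algebra of differential polynomials of order less than `e`. -/
abbrev orderLT (r e : ℕ) : Subalgebra ℝ (MvPolynomial (ℕ × Fin r) ℝ) :=
  supported ℝ {s | s.1 < e}

/-- The differential polynomial `P` has order at most `e`, is affine in the derivatives of order `e`,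
and `ℓ` is the (constant) vector of the coefficients of these derivatives. -/
def HasLeading (P : MvPolynomial (ℕ × Fin r) ℝ) (e : ℕ) (ℓ : Fin r → ℝ) : Prop :=
  P - ∑ j, C (ℓ j) * X (e, j) ∈ orderLT r e

theorem orderLT_mono {e e' : ℕ} (h : e ≤ e') : orderLT r e ≤ orderLT r e' :=
  supported_mono fun _ hs => lt_of_lt_of_le hs h

theorem X_mem_orderLT {i e : ℕ} (h : i < e) (j : Fin r) :
    (X (i, j) : MvPolynomial (ℕ × Fin r) ℝ) ∈ orderLT r e :=
  X_mem_supported.2 h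

theorem C_mem_orderLT (e : ℕ) (c : ℝ) : (C c : MvPolynomial (ℕ × Fin r) ℝ) ∈ orderLT r e :=
  Subalgebra.algebraMap_mem _ c

theorem jetDeriv_mem_orderLT {e : ℕ} {P : MvPolynomial (ℕ × Fin r) ℝ} (hP : P ∈ orderLT r e) :
    jetDeriv r P ∈ orderLT r (e + 1) := by
  rw [orderLT, supported_eq_adjoin_X] at hP
  induction hP using Algebra.adjoin_induction with
  | mem P h =>
    obtain ⟨s, hs, rfl⟩ := h
    rw [jetDeriv, mkDerivation_X]
    exact X_mem_orderLT (Nat.succ_lt_succ hs) _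
  | algebraMap c => simp
  | add P Q _ _ h₁ h₂ => rw [map_add]; exact add_mem h₁ h₂
  | mul P Q h₁ h₂ h₃ h₄ =>
    rw [← supported_eq_adjoin_X] at h₁ h₂
    rw [Derivation.leibniz, smul_eq_mul, smul_eq_mul]
    exact add_mem (mul_mem (orderLT_mono (Nat.le_succ e) h₁) h₄)
      (mul_mem (orderLT_mono (Nat.le_succ e) h₂) h₃)

namespace HasLeading

variable {P Q : MvPolynomial (ℕ × Fin r) ℝ} {e : ℕ} {ℓ ℓ' : Fin r → ℝ}

theorem mem_orderLT (h : HasLeading P e ℓ) : P ∈ orderLT r (e + 1) := by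
  rw [← sub_add_cancel P (∑ j, C (ℓ j) * X (e, j))]
  exact add_mem (orderLT_mono (Nat.le_succ e) h) (sum_mem fun j _ =>
    mul_mem (C_mem_orderLT _ _) (X_mem_orderLT (Nat.lt_succ_self e) j))

theorem add (h : HasLeading P e ℓ) (h' : HasLeading Q e ℓ') :
    HasLeading (P + Q) e (fun j => ℓ j + ℓ' j) := by
  have := add_mem h h'
  rw [HasLeading]
  convert this using 1
  simp only [C_add, add_mul, Finset.sum_add_distrib]
  ring

theorem neg (h : HasLeading P e ℓ) : HasLeading (-P) e (fun j => -ℓ j) := by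
  have := neg_mem h
  rw [HasLeading]
  convert this using 1
  simp only [C_neg, neg_mul, Finset.sum_neg_distrib]
  ring

theorem sub_of_mem (h : HasLeading P e ℓ) (hQ : Q ∈ orderLT r e) : HasLeading (P - Q) e ℓ := by
  have := sub_mem h hQ
  rw [HasLeading]
  convert this using 1
  ring

theorem jetDeriv (h : HasLeading P e ℓ) : HasLeading (jetDeriv r P) (e + 1) ℓ := by
  have := jetDeriv_mem_orderLT h
  rw [HasLeading]
  convert this using 1
  simp only [map_sub, map_sum, Derivation.leibniz, smul_eq_mul]
  congr 1
  refine Finset.sum_congr rfl fun j _ => ?_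
  rw [SemidiscreteToda.jetDeriv, mkDerivation_X, ← algebraMap_eq, Derivation.map_algebraMap]
  simp

end HasLeading

theorem hasDerivAt_evalJet {f : ℝ → Fin r → ℝ} {x₀ : ℝ} (hf : SmoothNear f x₀)
    (P : MvPolynomial (ℕ × Fin r) ℝ) :
    ∀ᶠ x in 𝓝 x₀, HasDerivAt (fun y => evalJet f y P) (evalJet f x (jetDeriv r P)) x := by
  have hs : ∀ i, SmoothNear (iteratedDeriv i f) x₀ := by
    intro i
    induction i with
    | zero => simpa using hf
    | succ i ih => rw [iteratedDeriv_succ]; exact ih.deriv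
  induction P using MvPolynomial.induction_on with
  | C c =>
    refine Filter.Eventually.of_forall fun x => ?_
    have e : jetDeriv r (C c) = 0 := (jetDeriv r).map_algebraMap c
    simpa [evalJet, e] using! hasDerivAt_const x c
  | add P Q h₁ h₂ =>
    filter_upwards [h₁, h₂] with x h₁ h₂
    simpa [evalJet] using! h₁.add h₂
  | mul_X P s h =>
    filter_upwards [h, (hs s.1).differentiable] with x h₁ h₂
    have h₃ := hasDerivAt_pi.1 h₂.hasDerivAt s.2
    rw [← iteratedDeriv_succ] at h₃
    refine ((h₁.mul h₃).congr_deriv ?_).congr_of_eventuallyEq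
      (Filter.Eventually.of_forall fun y => ?_)
    · simp only [evalJet, Derivation.leibniz, smul_eq_mul, jetDeriv, mkDerivation_X, map_add,
        map_mul, eval_X]
      ring
    · simp [evalJet]

theorem evalJet_opCoeff {f : ℝ → Fin r → ℝ} {x₀ : ℝ} (hf : SmoothNear f x₀)
    (a : ℕ → MvPolynomial (ℕ × Fin r) ℝ) (m k : ℕ) :
    (fun x => evalJet f x (opCoeff (jetDeriv r) a m k))
      =ᶠ[𝓝 x₀] opCoeff deriv (fun i x => evalJet f x (a i)) m k := by
  have hd : ∀ P, (fun x => evalJet f x (jetDeriv r P)) =ᶠ[𝓝 x₀] deriv fun x => evalJet f x P :=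
    fun P => (hasDerivAt_evalJet hf P).mono fun x hx => hx.deriv.symm
  induction m generalizing k with
  | zero => cases k <;> simp [opCoeff, evalJet] <;> rfl
  | succ m ih =>
    cases k with
    | zero =>
      filter_upwards [hd (opCoeff (jetDeriv r) a m 0), (ih 0).deriv, ih 0] with x h₁ h₂ h₃
      have e : evalJet f x (opCoeff (jetDeriv r) a (m + 1) 0)
          = evalJet f x (jetDeriv r (opCoeff (jetDeriv r) a m 0))
            - evalJet f x (a m) * evalJet f x (opCoeff (jetDeriv r) a m 0) := by
        simp [evalJet, opCoeff]
      rw [e, h₁, h₂, h₃]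
      rfl
    | succ k =>
      filter_upwards [hd (opCoeff (jetDeriv r) a m (k + 1)), (ih (k + 1)).deriv, ih (k + 1), ih k]
        with x h₁ h₂ h₃ h₄
      have e : evalJet f x (opCoeff (jetDeriv r) a (m + 1) (k + 1))
          = evalJet f x (jetDeriv r (opCoeff (jetDeriv r) a m (k + 1)))
            - evalJet f x (a m) * evalJet f x (opCoeff (jetDeriv r) a m (k + 1))
            + evalJet f x (opCoeff (jetDeriv r) a m k) := by
        simp [evalJet, opCoeff]
      rw [e, h₁, h₂, h₃, h₄]
      rfl

theorem contDiff_truncEval (d : ℕ) (P : MvPolynomial (ℕ × Fin r) ℝ) :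
    ContDiff ℝ ∞ (truncEval d P) := by
  induction P using MvPolynomial.induction_on with
  | C c =>
    have e : truncEval d (C c : MvPolynomial (ℕ × Fin r) ℝ) = fun _ => c :=
      funext fun z => eval_C c
    rw [e]
    exact contDiff_const
  | add P Q h₁ h₂ =>
    have e : truncEval d (P + Q) = fun z => truncEval d P z + truncEval d Q z :=
      funext fun z => map_add _ P Q
    rw [e]
    exact h₁.add h₂
  | mul_X P s h =>
    have e : truncEval d (P * X s) = fun z => truncEval d P z *
        if h : s.1 < d + 1 then z ⟨s.1, h⟩ s.2 else 0 :=
      funext fun z => by rw [truncEval, map_mul, eval_X]; rfl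
    rw [e]
    refine h.mul ?_
    split_ifs with h
    · fun_prop
    · exact contDiff_const

theorem eval_congr_of_mem_orderLT {e : ℕ} {P : MvPolynomial (ℕ × Fin r) ℝ} (hP : P ∈ orderLT r e)
    {f g : ℕ × Fin r → ℝ} (h : ∀ s, s.1 < e → f s = g s) : eval f P = eval g P :=
  eval₂Hom_congr' rfl (fun s hs _ => h s (mem_supported.1 hP hs)) rfl

theorem truncEval_jet {d : ℕ} {P : MvPolynomial (ℕ × Fin r) ℝ} (hP : P ∈ orderLT r (d + 1))
    (f : ℝ → Fin r → ℝ) (x : ℝ) : truncEval d P (jet d f x) = evalJet f x P :=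
  eval_congr_of_mem_orderLT hP fun s hs => by rw [dif_pos hs]; rfl

theorem HasLeading.partialAt_truncEval {d : ℕ} {P : MvPolynomial (ℕ × Fin r) ℝ} {ℓ : Fin r → ℝ}
    (h : HasLeading P d ℓ) (p : ℕ → Fin r → ℝ) (j : Fin r) :
    partialAt (truncEval d P) (Fin.last d) p j = ℓ j := by
  refine partialAt_eq_of_hasDerivAt (contDiff_truncEval d P) ?_
  have key : ∀ t : ℝ, truncEval d P ((fun l : Fin (d + 1) => p l) + t • coordVec (Fin.last d) j)
      = truncEval d P (fun l => p l) + t * ℓ j := by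
    intro t
    have e : ∀ z : Fin (d + 1) → Fin r → ℝ, truncEval d P z
        = truncEval d (P - ∑ j, C (ℓ j) * X (d, j)) z + ∑ i, ℓ i * z (Fin.last d) i := by
      intro z
      have : ∀ i, (if h : d < d + 1 then z ⟨d, h⟩ i else 0) = z (Fin.last d) i :=
        fun i => dif_pos (Nat.lt_succ_self d)
      simp only [truncEval, map_sub, map_sum, map_mul, eval_C, eval_X, this]
      ring
    rw [e, e fun l => p l]
    have low : truncEval d (P - ∑ j, C (ℓ j) * X (d, j))
        ((fun l : Fin (d + 1) => p l) + t • coordVec (Fin.last d) j)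
        = truncEval d (P - ∑ j, C (ℓ j) * X (d, j)) (fun l => p l) := by
      refine eval_congr_of_mem_orderLT h fun s hs => ?_
      have hne : (⟨s.1, by omega⟩ : Fin (d + 1)) ≠ Fin.last d := fun h => by
        have := congrArg Fin.val h
        simp only [Fin.val_last] at this
        omega
      have hs' : s.1 < d + 1 := by omega
      simp [hs', Pi.single_eq_of_ne hne]
    rw [low, add_assoc]
    congr 1
    simp only [Pi.add_apply, Pi.smul_apply, Pi.single_eq_same, smul_eq_mul, mul_add,
      Finset.sum_add_distrib]
    simp [Pi.single_apply, mul_comm]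
  simp only [key]
  simpa using ((hasDerivAt_id (0 : ℝ)).mul_const (ℓ j)).const_add (truncEval d P fun l => p l)

end DifferentialPolynomials

/-! ### The `n`-integrals of the lattice of the series `C` -/

section NIntegrals

open MvPolynomial

variable {r : ℕ} {u : ℤ → ℝ → Fin r → ℝ} {x₀ : ℝ}

/-- The functions `u_{n,x}(c) - u_{n,x}(c+1)`, `c = r - 1 - i`, where `u` is extended by
`reflectExt`. -/
def foldedSeq (u : ℤ → ℝ → Fin r → ℝ) (n : ℤ) (i : ℕ) (x : ℝ) : ℝ :=
  deriv (reflectExt u n (r - 1 - i)) x - deriv (reflectExt u n (r - i)) x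

theorem IsExpSolution.opCoeff_foldedSeq (hu : IsExpSolution (cMatrix r) u x₀) {m : ℕ} (hm : m < r)
    (n : ℤ) (k : ℕ) :
    opCoeff deriv (foldedSeq u n) (m + 1) k =ᶠ[𝓝 x₀] fun x =>
      opCoeff deriv (foldedSeq u (n + 1)) (m + 1) k x
        + -laplaceInv (1 - (r : ℤ)) r (reduced u) n (r - 1 - m) x
          * opCoeff deriv (foldedSeq u (n + 1)) m k x := by
  refine opCoeff_darboux
    (h := fun i x => -laplaceInv (1 - (r : ℤ)) r (reduced u) n (r - 1 - i) x)
    (fun i _ => (hu.smoothNear_reflectExt _ _).deriv.sub (hu.smoothNear_reflectExt _ _).deriv)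
    (fun i _ => (hu.isASolution.smoothNear_laplaceInv n).mono fun x hx => hx.neg) ?_
    (fun i _ => ?_) (fun i hi => ?_) k
  · filter_upwards [hu.deriv_reflectExt_sub n (r - 1 - (0 : ℕ)),
      hu.deriv_reflectExt_sub n (r - (0 : ℕ))] with x h₁ h₂
    rw [laplaceInv_of_ge (j := r - (0 : ℕ)) (by omega)] at h₂
    simp only [foldedSeq]
    linear_combination h₂ - h₁
  · filter_upwards [hu.deriv_reflectExt_sub n (r - 1 - (i + 1 : ℕ)),
      hu.deriv_reflectExt_sub n (r - (i + 1 : ℕ))] with x h₁ h₂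
    simp only [foldedSeq]
    rw [show (r - 1 - i : ℤ) = r - (i + 1 : ℕ) by push_cast; ring]
    linear_combination h₂ - h₁
  · have e : (fun x => -laplaceInv (1 - (r : ℤ)) r (reduced u) n (r - 1 - i) x)
        = fun x => -Real.exp (reflectExt u (n + 1) (r - i) x - reflectExt u (n + 1) (r - 1 - i) x
          - reflectExt u n (r - 1 - i) x + reflectExt u n (r - 1 - (i + 1 : ℕ)) x) := by
      funext x
      rw [laplaceInv_of_mem (by omega) (by omega), reduced_sub_reduced]
      push_cast
      ring_nf
    filter_upwards [(hu.smoothNear_reflectExt (n + 1) (r - i)).differentiable,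
      (hu.smoothNear_reflectExt (n + 1) (r - 1 - i)).differentiable,
      (hu.smoothNear_reflectExt n (r - 1 - i)).differentiable,
      (hu.smoothNear_reflectExt n (r - 1 - (i + 1 : ℕ))).differentiable] with x h₁ h₂ h₃ h₄
    have ex := congrFun e x
    rw [ex, e]
    refine ((((h₁.hasDerivAt.sub h₂.hasDerivAt).sub h₃.hasDerivAt).add
      h₄.hasDerivAt).exp.neg.deriv).trans ?_
    simp only [foldedSeq, Pi.add_apply, Pi.sub_apply,
      show (r - (i + 1 : ℕ) : ℤ) = r - 1 - i by push_cast; ring]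
    ring

/-- The right half of the reduced operator is the same for `q_n(j)` and for
`-q_n(1-j) = u_n(-j) - u_n(1-j)`. -/
theorem IsExpSolution.opCoeff_reduced (hu : IsExpSolution (cMatrix r) u x₀) {m : ℕ} (hm : m ≤ r)
    (n : ℤ) (k : ℕ) :
    opCoeff deriv (fun i => deriv (reduced u n (1 - (r : ℤ) + i))) m k
      =ᶠ[𝓝 x₀] opCoeff deriv (foldedSeq u (n + r - m)) m k := by
  induction m generalizing k with
  | zero => cases k <;> rfl
  | succ m ih =>
    have ih' := ih (by omega)
    have step := hu.opCoeff_foldedSeq (m := m) (by omega) (n + r - (m + 1 : ℕ))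
    rw [show n + r - (m + 1 : ℕ) + 1 = n + r - m by push_cast; ring] at step
    -- the factor `∂ - q_{n,x}(-c)`, `c = r - 1 - m`
    have factor : ∀ᶠ x in 𝓝 x₀, deriv (reduced u n (1 - (r : ℤ) + m)) x
        = foldedSeq u (n + r - m) m x
          + laplaceInv (1 - (r : ℤ)) r (reduced u) (n + r - (m + 1 : ℕ)) (r - 1 - m) x := by
      filter_upwards [hu.deriv_reduced n (1 - (r : ℤ) + m),
        hu.deriv_reflectExt_sub (n + r - (m + 1 : ℕ)) (r - 1 - m)] with x h₁ h₂
      rw [h₁, ← h₂, show (1 - (r : ℤ) + m) = -(r - 1 - m) by ring,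
        show (-(r - 1 - m) - 1 : ℤ) = -(r - m) by ring, reflectExt_neg, reflectExt_neg, foldedSeq,
        show n + r - (m + 1 : ℕ) + 1 = n + r - m by push_cast; ring,
        show n + (r - 1 - m) = n + r - (m + 1 : ℕ) by push_cast; ring,
        show n + (r - m) = n + r - m by ring]
      ring
    cases k with
    | zero =>
      filter_upwards [ih' 0, (ih' 0).deriv, step 0, factor] with x h₁ h₂ h₃ h₄
      have e : opCoeff deriv (foldedSeq u (n + r - m)) (m + 1) 0 x
        = deriv (opCoeff deriv (foldedSeq u (n + r - m)) m 0) x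
          - foldedSeq u (n + r - m) m x * opCoeff deriv (foldedSeq u (n + r - m)) m 0 x := rfl
      have e' : opCoeff deriv (fun i : ℕ => deriv (reduced u n (1 - (r : ℤ) + i))) (m + 1) 0 x
        = deriv (opCoeff deriv (fun i : ℕ => deriv (reduced u n (1 - (r : ℤ) + i))) m 0) x
          - deriv (reduced u n (1 - (r : ℤ) + m)) x
            * opCoeff deriv (fun i : ℕ => deriv (reduced u n (1 - (r : ℤ) + i))) m 0 x := rfl
      rw [h₃, e, e', h₁, h₂, h₄]
      ring
    | succ k =>
      filter_upwards [ih' (k + 1), (ih' (k + 1)).deriv, ih' k, step (k + 1), factor]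
        with x h₁ h₂ h₀ h₃ h₄
      have e : opCoeff deriv (foldedSeq u (n + r - m)) (m + 1) (k + 1) x
        = deriv (opCoeff deriv (foldedSeq u (n + r - m)) m (k + 1)) x
          - foldedSeq u (n + r - m) m x * opCoeff deriv (foldedSeq u (n + r - m)) m (k + 1) x
          + opCoeff deriv (foldedSeq u (n + r - m)) m k x := rfl
      have e' : opCoeff deriv (fun i : ℕ => deriv (reduced u n (1 - (r : ℤ) + i))) (m + 1) (k + 1) x
        = deriv (opCoeff deriv (fun i : ℕ => deriv (reduced u n (1 - (r : ℤ) + i))) m (k + 1)) x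
          - deriv (reduced u n (1 - (r : ℤ) + m)) x
            * opCoeff deriv (fun i : ℕ => deriv (reduced u n (1 - (r : ℤ) + i))) m (k + 1) x
          + opCoeff deriv (fun i : ℕ => deriv (reduced u n (1 - (r : ℤ) + i))) m k x := rfl
      rw [h₃, e, e', h₁, h₂, h₀, h₄]
      ring

/-- The variable that stands for `u_x(c)`, where `u(c) = 0` for `c ≥ r`. -/
def firstJet (r c : ℕ) : MvPolynomial (ℕ × Fin r) ℝ :=
  if h : c < r then X (1, ⟨c, h⟩) else 0

/-- The differential polynomials `s_i` in `u(0), …, u(r-1)` for which the operator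
`(∂ - s_{2r-1}) ⋯ (∂ - s_0)` is equal to
`(∂ - v_r) ⋯ (∂ - v_1) (∂ + v_1) ⋯ (∂ + v_r)`, where `v_j = u_x(j) - u_x(j-1)`. -/
def foldedJet (r i : ℕ) : MvPolynomial (ℕ × Fin r) ℝ :=
  if i < r then firstJet r (r - 1 - i) - firstJet r (r - i)
  else firstJet r (i - r + 1) - firstJet r (i - r)

/-- The coefficient of `∂^k` of the operator `(∂ - v_r) ⋯ (∂ - v_1) (∂ + v_1) ⋯ (∂ + v_r)`, where
`v_j = u_x(j) - u_x(j-1)` and `u(r) = 0`. -/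
def nIntegralPoly (r k : ℕ) : MvPolynomial (ℕ × Fin r) ℝ :=
  opCoeff (jetDeriv r) (foldedJet r) (2 * r) k

theorem IsExpSolution.evalJet_firstJet (hu : IsExpSolution (cMatrix r) u x₀) (n : ℤ) (c : ℕ) :
    ∀ᶠ x in 𝓝 x₀, evalJet (u n) x (firstJet r c) = deriv (reflectExt u n c) x := by
  by_cases h : c < r
  · filter_upwards [SmoothNear.differentiable (hu.1 n)] with x hx
    rw [reflectExt_of_nonneg (by omega) (by omega), firstJet, dif_pos h,
      (hasDerivAt_pi.1 hx.hasDerivAt _).deriv]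
    simp [evalJet]
  · refine Filter.Eventually.of_forall fun x => ?_
    rw [reflectExt_of_le (by omega), firstJet, dif_neg h]
    simp [evalJet]

theorem IsExpSolution.diffCoeff_reduced (hu : IsExpSolution (cMatrix r) u x₀) (n : ℤ) (k : ℕ) :
    diffCoeff (reduced u) (1 - (r : ℤ)) n (2 * r) k x₀ = evalJet (u n) x₀ (nIntegralPoly r k) := by
  rw [diffCoeff_eq_opCoeff, nIntegralPoly]
  refine Eq.trans ?_ (evalJet_opCoeff (hu.1 n) (foldedJet r) (2 * r) k).self_of_nhds.symm
  refine (opCoeff_congr (m₀ := r) (by omega) (fun k => ?_) (fun i h₁ h₂ => ?_) k).self_of_nhds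
  · refine (hu.opCoeff_reduced le_rfl n k).trans
      (opCoeff_congr (Nat.zero_le r) (fun k => by cases k <;> rfl) (fun i _ hi => ?_) k)
    filter_upwards [hu.evalJet_firstJet n (r - 1 - i), hu.evalJet_firstJet n (r - i)] with x h₁ h₂
    rw [foldedSeq, foldedJet, if_pos hi, evalJet, map_sub, ← evalJet, ← evalJet, h₁, h₂,
      show ((r - 1 - i : ℕ) : ℤ) = r - 1 - i by omega, show ((r - i : ℕ) : ℤ) = r - i by omega,
      add_sub_cancel_right]
  · filter_upwards [hu.evalJet_firstJet n (i - r + 1), hu.evalJet_firstJet n (i - r),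
      hu.deriv_reduced n (1 - (r : ℤ) + i)] with x h₃ h₄ h₅
    rw [h₅, foldedJet, if_neg (by omega), evalJet, map_sub, ← evalJet, ← evalJet, h₃, h₄,
      show ((i - r + 1 : ℕ) : ℤ) = 1 - r + i by omega,
      show ((i - r : ℕ) : ℤ) = 1 - r + i - 1 by omega]

theorem firstJet_mem_orderLT (r c : ℕ) : firstJet r c ∈ orderLT r 2 := by
  rw [firstJet]
  split_ifs
  · exact X_mem_orderLT (by norm_num) _
  · exact zero_mem _

theorem foldedJet_mem_orderLT (r i : ℕ) : foldedJet r i ∈ orderLT r 2 := by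
  rw [foldedJet]
  split_ifs <;> exact sub_mem (firstJet_mem_orderLT r _) (firstJet_mem_orderLT r _)

theorem hasLeading_firstJet (r c : ℕ) :
    HasLeading (firstJet r c) 1 fun j => if (j : ℕ) = c then 1 else 0 := by
  have e : firstJet r c
      = ∑ j : Fin r, C (if (j : ℕ) = c then (1 : ℝ) else 0) * X ((1 : ℕ), j) := by
    rw [firstJet]
    split_ifs with h
    · rw [Finset.sum_eq_single ⟨c, h⟩]
      · simp
      · intro j _ hj
        rw [if_neg fun h' => hj (Fin.ext h')]
        simp
      · simp
    · refine (Finset.sum_eq_zero fun j _ => ?_).symm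
      rw [if_neg (by omega)]
      simp
  rw [HasLeading, e, sub_self]
  exact zero_mem _

theorem opCoeff_jetDeriv_of_lt (a : ℕ → MvPolynomial (ℕ × Fin r) ℝ) {m k : ℕ} (h : m < k) :
    opCoeff (jetDeriv r) a m k = 0 := by
  induction m generalizing k with
  | zero =>
    obtain ⟨k, rfl⟩ := Nat.exists_eq_succ_of_ne_zero h.ne'
    rfl
  | succ m ih =>
    obtain ⟨k, rfl⟩ := Nat.exists_eq_succ_of_ne_zero (by omega : k ≠ 0)
    simp [opCoeff, ih (by omega : m < k + 1), ih (by omega : m < k)]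

theorem opCoeff_jetDeriv_self (a : ℕ → MvPolynomial (ℕ × Fin r) ℝ) (m : ℕ) :
    opCoeff (jetDeriv r) a m m = 1 := by
  induction m with
  | zero => rfl
  | succ m ih => simp [opCoeff, ih, opCoeff_jetDeriv_of_lt a (Nat.lt_succ_self m)]

/-- The coefficient of `∂^k` in the product of the `k + e + 1` rightmost factors has order `e + 1`.
Its leading coefficients form an antitriangular matrix: up to a combination of the leading
coefficients of `s_0, …, s_{k-1}`, they are those of `-s_k = u_x(r-k) - u_x(r-1-k)`. -/
theorem exists_hasLeading_opCoeff {m k e : ℕ} (hk : k < r) (hm : m = k + e + 1) :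
    ∃ ℓ : Fin r → ℝ, HasLeading (opCoeff (jetDeriv r) (foldedJet r) m k) (e + 1) ℓ ∧
      (∀ j : Fin r, (j : ℕ) + k + 1 < r → ℓ j = 0) ∧
      (∀ j : Fin r, (j : ℕ) + k + 1 = r → ℓ j = -1) := by
  induction m generalizing k e with
  | zero => omega
  | succ m ih =>
    obtain rfl : m = k + e := by omega
    have first : ∃ ℓ : Fin r → ℝ,
        HasLeading (jetDeriv r (opCoeff (jetDeriv r) (foldedJet r) (k + e) k)
          - foldedJet r (k + e) * opCoeff (jetDeriv r) (foldedJet r) (k + e) k) (e + 1) ℓ ∧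
        (∀ j : Fin r, (j : ℕ) + k + 1 < r → ℓ j = 0) ∧
        (∀ j : Fin r, (j : ℕ) + k + 1 = r → ℓ j = -1) := by
      cases e with
      | zero =>
        refine ⟨fun j => (if (j : ℕ) = r - k then 1 else 0)
          + -(if (j : ℕ) = r - 1 - k then 1 else 0), ?_, fun j hj => ?_, fun j hj => ?_⟩
        · rw [add_zero, opCoeff_jetDeriv_self, (jetDeriv r).map_one_eq_zero, mul_one, zero_sub,
            foldedJet, if_pos hk, neg_sub, sub_eq_add_neg]
          exact (hasLeading_firstJet r _).add (hasLeading_firstJet r _).neg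
        · simp only
          rw [if_neg (by omega), if_neg (by omega)]
          norm_num
        · simp only
          rw [if_neg (by omega), if_pos (by omega)]
          norm_num
      | succ e =>
        obtain ⟨ℓ, h₁, h₂, h₃⟩ := ih hk (e := e) (by omega)
        refine ⟨ℓ, h₁.jetDeriv.sub_of_mem (mul_mem ?_ h₁.mem_orderLT), h₂, h₃⟩
        exact orderLT_mono (by omega) (foldedJet_mem_orderLT r _)
    obtain ⟨ℓ, h₁, h₂, h₃⟩ := first
    cases k with
    | zero => exact ⟨ℓ, h₁, h₂, h₃⟩
    | succ k =>
      obtain ⟨ℓ', h₁', h₂', -⟩ := ih (k := k) (e := e) (by omega) (by omega)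
      refine ⟨_, h₁.add h₁', fun j hj => ?_, fun j hj => ?_⟩
      · rw [h₂ j hj, h₂' j (by omega), add_zero]
      · rw [h₃ j hj, h₂' j (by omega), add_zero]

theorem exists_nIntegrals (hr : 1 ≤ r) :
    ∃ (k : Fin r → ℕ) (d : Fin r → ℕ) (I : ∀ i, (Fin (d i + 1) → Fin r → ℝ) → ℝ),
      StrictMono k ∧ (∀ i, k i < 2 * r) ∧
      (∀ i, IsNIntegral (cMatrix r) (d i) (I i)) ∧
      (∀ (u : ℤ → ℝ → Fin r → ℝ) (x₀ : ℝ),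
        IsExpSolution (cMatrix r) u x₀ → ∀ (n : ℤ) (i : Fin r),
          I i (jet (d i) (u n) x₀)
            = diffCoeff (reduced u) (1 - (r : ℤ)) n (2 * r) (k i) x₀) ∧
      EssentiallyIndependent d I := by
  have hlead : ∀ i : Fin r, ∃ ℓ : Fin r → ℝ,
      HasLeading (nIntegralPoly r i) (2 * r - i) ℓ ∧
      (∀ j : Fin r, (j : ℕ) + i + 1 < r → ℓ j = 0) ∧
      (∀ j : Fin r, (j : ℕ) + i + 1 = r → ℓ j = -1) := by
    intro i
    have := exists_hasLeading_opCoeff (r := r) (m := 2 * r) (e := 2 * r - i - 1) i.isLt (by omega)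
    rwa [show 2 * r - i - 1 + 1 = 2 * r - i by omega] at this
  choose ℓ h₁ h₂ h₃ using hlead
  have value : ∀ (u : ℤ → ℝ → Fin r → ℝ) (x₀ : ℝ),
      IsExpSolution (cMatrix r) u x₀ → ∀ (n : ℤ) (i : Fin r),
        truncEval (2 * r - i) (nIntegralPoly r i) (jet (2 * r - i) (u n) x₀)
          = diffCoeff (reduced u) (1 - (r : ℤ)) n (2 * r) i x₀ := by
    intro u x₀ hu n i
    rw [truncEval_jet (h₁ i).mem_orderLT, hu.diffCoeff_reduced]
  refine ⟨fun i => i, fun i => 2 * r - i, fun i => truncEval _ (nIntegralPoly r i),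
    fun i j hij => hij, fun i => by have := i.isLt; dsimp only; omega,
    fun i => ⟨contDiff_truncEval _ _, ?_, ?_⟩, value, fun p => ?_⟩
  · refine ⟨0, i.rev, ?_⟩
    rw [(h₁ i).partialAt_truncEval, h₃ i _ (by simp; omega)]
    norm_num
  · intro u x₀ hu n
    refine (value u x₀ hu n i).trans (Eq.trans ?_ (value u x₀ hu (n + 1) i).symm)
    obtain ⟨m, hm⟩ : ∃ m, 2 * r = m + 1 := ⟨2 * r - 1, by omega⟩
    rw [hm]
    exact hu.isASolution.diffCoeff_succ (by omega) n _
  · refine rank_eq_of_antitriangular (fun i j hij => ?_) (fun i j hij => ?_)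
    · rw [Matrix.of_apply, (h₁ i).partialAt_truncEval, h₂ i j hij]
    · rw [Matrix.of_apply, (h₁ i).partialAt_truncEval, h₃ i j hij]
      norm_num

end NIntegrals

/-! ### The `x`-integrals of the lattice of the series `C` -/

section XIntegrals

variable {r : ℕ}

/-- The reflection `reflectExt` of a sequence of vectors that do not depend on `x`. -/
def reflectSeq (v : ℤ → Fin r → ℝ) (n j : ℤ) : ℝ :=
  reflectExt (fun l _ => v l) n j 0

/-- The weight `G_n(j) / G_{n+1}(j+1)`, where `G_n(j) = exp (u_n(j) - u_{n+1}(j))`. -/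
def weight (v : ℤ → Fin r → ℝ) (n j : ℤ) : ℝ :=
  Real.exp (reflectSeq v n j - reflectSeq v (n + 1) j - reflectSeq v (n + 1) (j + 1)
    + reflectSeq v (n + 2) (j + 1))

/-- The sum of the products `weight n j₁ * weight (n+1) j₂ * ⋯ * weight (n+k-1) jₖ` over all
`r - m ≤ j₁ < j₂ < ⋯ < jₖ < r`. -/
def weightSum (v : ℤ → Fin r → ℝ) : ℕ → ℕ → ℤ → ℝ
  | 0, 0, _ => 1
  | 0, _ + 1, _ => 0
  | _ + 1, 0, _ => 1
  | m + 1, k + 1, n => weightSum v m (k + 1) n + weight v n (r - m - 1) * weightSum v m k (n + 1)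

theorem weightSum_zero (v : ℤ → Fin r → ℝ) (m : ℕ) (n : ℤ) : weightSum v m 0 n = 1 := by
  cases m <;> rfl

theorem weightSum_succ (v : ℤ → Fin r → ℝ) (m k : ℕ) (n : ℤ) :
    weightSum v (m + 1) (k + 1) n
      = weightSum v m (k + 1) n + weight v n (r - m - 1) * weightSum v m k (n + 1) := rfl

theorem weight_pos (v : ℤ → Fin r → ℝ) (n j : ℤ) : 0 < weight v n j := Real.exp_pos _

theorem weightSum_nonneg (v : ℤ → Fin r → ℝ) (m k : ℕ) (n : ℤ) : 0 ≤ weightSum v m k n := by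
  induction m generalizing k n with
  | zero => cases k <;> simp [weightSum]
  | succ m ih =>
    cases k with
    | zero => simp [weightSum]
    | succ k => exact add_nonneg (ih _ _) (mul_nonneg (weight_pos v _ _).le (ih _ _))

theorem weightSum_pos (v : ℤ → Fin r → ℝ) {m k : ℕ} (h : k ≤ m) (n : ℤ) :
    0 < weightSum v m k n := by
  induction m generalizing k n with
  | zero =>
    obtain rfl : k = 0 := by omega
    simp [weightSum]
  | succ m ih =>
    cases k with
    | zero => simp [weightSum]
    | succ k =>
      exact add_pos_of_nonneg_of_pos (weightSum_nonneg v _ _ _)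
        (mul_pos (weight_pos v _ _) (ih (by omega) _))

/-- After telescoping, the coefficients of the products of shift operators become sums over the
positions of the factors `T`. -/
theorem shiftCoeff_reduced (u : ℤ → ℝ → Fin r → ℝ) (m k : ℕ) (n : ℤ) (x : ℝ) :
    shiftCoeff (reduced u) r m k n x = weightSum (fun l => u l x) m k n
      * Real.exp (reflectExt u (n + 1) (r - m) x - reflectExt u n (r - m) x) := by
  have step : ∀ m n, Real.exp (reduced u n (r - m) x - reduced u (n + 1) (r - m) x)
      * Real.exp (reflectExt u (n + 1) (r - m) x - reflectExt u n (r - m) x)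
      = Real.exp (reflectExt u (n + 1) (r - m - 1) x - reflectExt u n (r - m - 1) x) := by
    intro m n
    rw [← Real.exp_add, reduced, reduced]
    congr 1
    ring
  induction m generalizing k n with
  | zero =>
    rw [reflectExt_of_le (by omega), reflectExt_of_le (by omega)]
    cases k <;> simp [shiftCoeff, weightSum]
  | succ m ih =>
    have cast : (r - (m + 1 : ℕ) : ℤ) = r - m - 1 := by push_cast; ring
    cases k with
    | zero =>
      simp only [shiftCoeff]
      rw [ih, weightSum_zero, weightSum_zero, one_mul, one_mul, step, cast]
    | succ k =>
      have hw : weight (fun l => u l x) n (r - m - 1)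
          * Real.exp (reflectExt u (n + 1) (r - m - 1) x - reflectExt u n (r - m - 1) x)
          = Real.exp (reflectExt u (n + 1 + 1) (r - m) x - reflectExt u (n + 1) (r - m) x) := by
        change Real.exp (reflectExt u n (r - m - 1) x - reflectExt u (n + 1) (r - m - 1) x
          - reflectExt u (n + 1) (r - m - 1 + 1) x + reflectExt u (n + 2) (r - m - 1 + 1) x) * _ = _
        rw [← Real.exp_add, sub_add_cancel, add_assoc n 1 1, one_add_one_eq_two]
        congr 1
        ring
      simp only [shiftCoeff]
      rw [ih, ih, weightSum_succ, cast, ← hw, ← step]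
      ring

theorem reflectSeq_congr {v v' : ℤ → Fin r → ℝ} {n j : ℤ} (hj : 0 ≤ j)
    (h : ∀ c : Fin r, (c : ℤ) = j → v n c = v' n c) : reflectSeq v n j = reflectSeq v' n j := by
  by_cases hr : j < r
  · rw [reflectSeq, reflectSeq, reflectExt_of_nonneg hj hr, reflectExt_of_nonneg hj hr]
    exact h _ (Int.toNat_of_nonneg hj)
  · rw [reflectSeq, reflectSeq, reflectExt_of_le (by omega), reflectExt_of_le (by omega)]

theorem weight_neg (v : ℤ → Fin r → ℝ) (n i : ℤ) :
    weight v n (-i) = Real.exp (reflectSeq v (n + i) i - reflectSeq v (n + i + 1) i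
      - reflectSeq v (n + i) (i - 1) + reflectSeq v (n + i + 1) (i - 1)) := by
  rw [weight, show -i + 1 = -(i - 1) by ring]
  simp only [reflectSeq, reflectExt_neg]
  ring_nf

theorem weight_congr_of_nonneg {v v' : ℤ → Fin r → ℝ} {n j : ℤ} (hj : 0 ≤ j)
    (h : ∀ l (c : Fin r), (l = n ∧ (c : ℤ) = j ∨ l = n + 1 ∨ l = n + 2 ∧ (c : ℕ) ≠ 0) →
      v l c = v' l c) : weight v n j = weight v' n j := by
  rw [weight, weight, reflectSeq_congr hj fun c hc => h n c (by omega),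
    reflectSeq_congr hj fun c hc => h (n + 1) c (by omega),
    reflectSeq_congr (by omega) fun c hc => h (n + 1) c (by omega),
    reflectSeq_congr (by omega) fun c hc => h (n + 2) c (by omega)]

theorem weight_congr_of_neg {v v' : ℤ → Fin r → ℝ} {n i : ℤ} (hi : 0 < i)
    (h : ∀ l (c : Fin r), (l = n + i ∨ l = n + i + 1 ∧ ((c : ℤ) = i ∨ (c : ℤ) = i - 1)) →
      v l c = v' l c) : weight v n (-i) = weight v' n (-i) := by
  rw [weight_neg, weight_neg, reflectSeq_congr hi.le fun c hc => h (n + i) c (by omega),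
    reflectSeq_congr hi.le fun c hc => h (n + i + 1) c (by omega),
    reflectSeq_congr (by omega) fun c hc => h (n + i) c (by omega),
    reflectSeq_congr (by omega) fun c hc => h (n + i + 1) c (by omega)]

theorem weightSum_congr {v v' : ℤ → Fin r → ℝ} {m k : ℕ} {n : ℤ}
    (h : ∀ l (c : Fin r), n ≤ l →
      (l ≤ n + m - r + 1 ∨ l < n + k + 1 ∨ l = n + k + 1 ∧ (c : ℕ) ≠ 0) → v l c = v' l c) :
    weightSum v m k n = weightSum v' m k n := by
  induction m generalizing k n with
  | zero => cases k <;> rfl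
  | succ m ih =>
    cases k with
    | zero => rfl
    | succ k =>
      have hw : weight v n (r - m - 1) = weight v' n (r - m - 1) := by
        rcases le_or_gt 0 (r - m - 1 : ℤ) with hj | hj
        · exact weight_congr_of_nonneg hj fun l c hl => h l c (by omega) (by push_cast; omega)
        · rw [show (r - m - 1 : ℤ) = -(m + 1 - r) by ring]
          exact weight_congr_of_neg (by omega) fun l c hl => h l c (by omega) (by push_cast; omega)
      rw [weightSum_succ, weightSum_succ, hw,
        ih fun l c h₁ h₂ => h l c h₁ (by push_cast at h₂ ⊢; omega),
        ih fun l c h₁ h₂ => h l c (by omega) (by push_cast; omega)]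

theorem weightSum_shift (v : ℤ → Fin r → ℝ) (n₀ : ℤ) (m k : ℕ) (n : ℤ) :
    weightSum (fun l => v (n₀ + l)) m k n = weightSum v m k (n₀ + n) := by
  have hs : ∀ n j, reflectSeq (fun l => v (n₀ + l)) n j = reflectSeq v (n₀ + n) j := by
    intro n j
    simp only [reflectSeq, reflectExt, add_assoc]
  induction m generalizing k n with
  | zero => cases k <;> rfl
  | succ m ih =>
    cases k with
    | zero => rfl
    | succ k => simp only [weightSum_succ, weight, ih, hs, add_assoc]

/-! ### Dependence of the `x`-integrals on the first and on the last vector -/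

/-- The sequence `v` with the `c`-th coordinate of `v N` increased by `t`. -/
def bump (v : ℤ → Fin r → ℝ) (N : ℤ) (c : Fin r) (t : ℝ) (l : ℤ) (d : Fin r) : ℝ :=
  if l = N ∧ d = c then v l d + t else v l d

theorem bump_of_not {v : ℤ → Fin r → ℝ} {N : ℤ} {c : Fin r} {t : ℝ} {l : ℤ} {d : Fin r}
    (h : ¬(l = N ∧ (d : ℕ) = c)) : bump v N c t l d = v l d :=
  if_neg fun h' => h ⟨h'.1, congrArg Fin.val h'.2⟩

theorem reflectSeq_bump_self (v : ℤ → Fin r → ℝ) (N : ℤ) (c : Fin r) (t : ℝ) :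
    reflectSeq (bump v N c t) N c = reflectSeq v N c + t := by
  rw [reflectSeq, reflectSeq, reflectExt_coe, reflectExt_coe, bump, if_pos ⟨rfl, rfl⟩]

theorem reflectSeq_bump_of_ne (v : ℤ → Fin r → ℝ) {N n j : ℤ} {c : Fin r} (t : ℝ) (hj : 0 ≤ j)
    (h : ¬(n = N ∧ j = c)) : reflectSeq (bump v N c t) n j = reflectSeq v n j :=
  reflectSeq_congr hj fun d hd => bump_of_not fun h' => h ⟨h'.1, by omega⟩

/-- The dependence of `weightSum v m b n` on the coordinates `c ≤ m - r - b` of the vector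
`v (n + m - r + 1)`. There is none for `c < m - r - b`. For `c = m - r - b` the coordinate enters
only the product of the `b` leftmost weights, through the factor `exp (v (n + m - r + 1) c)`. -/
theorem exists_weightSum_bump_last (v : ℤ → Fin r → ℝ) {m b : ℕ} (hb : 1 ≤ b) (n : ℤ) (c : Fin r)
    (h : c + b + r ≤ m) :
    ∃ B : ℝ, (c + b + r < m → B = 0) ∧ (c + b + r = m → 0 < B) ∧
      ∀ t, weightSum (bump v (n + m - r + 1) c t) m b n
        = weightSum v m b n + B * (Real.exp t - 1) := by
  induction m generalizing b n with
  | zero => omega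
  | succ m ih =>
    obtain ⟨b, rfl⟩ : ∃ b', b = b' + 1 := ⟨b - 1, by omega⟩
    have hN : (n + (m + 1 : ℕ) - r + 1 : ℤ) = n + 1 + m - r + 1 := by push_cast; ring
    have hj : (r - m - 1 : ℤ) = -(m + 1 - r) := by ring
    have first : ∀ t, weightSum (bump v (n + (m + 1 : ℕ) - r + 1) c t) m (b + 1) n
        = weightSum v m (b + 1) n :=
      fun t => weightSum_congr fun l d h₁ h₂ => bump_of_not (by push_cast at h₂ ⊢; omega)
    have hw : c + (b + 1) + r < m + 1 ∨ 1 ≤ b → ∀ t,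
        weight (bump v (n + (m + 1 : ℕ) - r + 1) c t) n (r - m - 1) = weight v n (r - m - 1) := by
      intro hc t
      rw [hj]
      exact weight_congr_of_neg (by omega) fun l d hl => bump_of_not (by push_cast; omega)
    rcases Nat.eq_zero_or_pos b with rfl | hb'
    · rcases h.lt_or_eq with hlt | heq
      · refine ⟨0, fun _ => rfl, fun h' => by omega, fun t => ?_⟩
        rw [weightSum_succ, weightSum_succ, first, hw (Or.inl hlt), weightSum_zero, weightSum_zero]
        ring
      · refine ⟨weight v n (r - m - 1), fun h' => by omega, fun _ => weight_pos _ _ _, fun t => ?_⟩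
        have hw' : weight (bump v (n + (m + 1 : ℕ) - r + 1) c t) n (r - m - 1)
            = weight v n (r - m - 1) * Real.exp t := by
          have hc : (m + 1 - r - 1 : ℤ) = c := by omega
          have hN' : (n + (m + 1 - r) + 1 : ℤ) = n + (m + 1 : ℕ) - r + 1 := by push_cast; ring
          rw [hj, weight_neg, weight_neg, hc, hN', reflectSeq_bump_self,
            reflectSeq_bump_of_ne _ _ (by omega) (by omega),
            reflectSeq_bump_of_ne _ _ (by omega) (by omega),
            reflectSeq_bump_of_ne _ _ (by omega) (by omega), ← Real.exp_add]
          congr 1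
          ring
        rw [weightSum_succ, weightSum_succ, first, hw', weightSum_zero, weightSum_zero]
        ring
    · obtain ⟨B, h₁, h₂, h₃⟩ := ih hb' (n + 1) (by omega)
      refine ⟨weight v n (r - m - 1) * B, fun h' => ?_, fun h' => ?_, fun t => ?_⟩
      · rw [h₁ (by omega), mul_zero]
      · exact mul_pos (weight_pos _ _ _) (h₂ (by omega))
      · rw [weightSum_succ, weightSum_succ, first, hw (Or.inr hb'), hN, h₃]
        ring

/-- `weightSum v m (k + 1) n` depends on the zeroth coordinate of `v n` only through
`weight v n 0`. -/
theorem exists_weightSum_bump_first (v : ℤ → Fin r → ℝ) (m : ℕ) {k : ℕ} (hk : k < r) (n : ℤ)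
    (c : Fin r) (hc : (c : ℕ) = 0) :
    ∃ B : ℝ, (m < r → B = 0) ∧ (r ≤ m → 0 < B) ∧
      ∀ t, weightSum (bump v n c t) m (k + 1) n
        = weightSum v m (k + 1) n + B * (Real.exp t - 1) := by
  induction m with
  | zero => exact ⟨0, fun _ => rfl, fun h => by omega, fun t => by simp [weightSum]⟩
  | succ m ih =>
    obtain ⟨B, h₁, h₂, h₃⟩ := ih
    have rest : ∀ t, weightSum (bump v n c t) m k (n + 1) = weightSum v m k (n + 1) :=
      fun t => weightSum_congr fun l d h₁ h₂ => bump_of_not (by omega)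
    rcases eq_or_ne (m + 1) r with heq | hne
    · refine ⟨weight v n (r - m - 1) * weightSum v m k (n + 1), fun h' => by omega,
        fun _ => mul_pos (weight_pos _ _ _) (weightSum_pos v (by omega) _), fun t => ?_⟩
      have hw : weight (bump v n c t) n (r - m - 1) = weight v n (r - m - 1) * Real.exp t := by
        have hj : (r - m - 1 : ℤ) = c := by omega
        rw [hj, weight, weight, reflectSeq_bump_self,
          reflectSeq_bump_of_ne _ _ (by omega) (by omega),
          reflectSeq_bump_of_ne _ _ (by omega) (by omega),
          reflectSeq_bump_of_ne _ _ (by omega) (by omega), ← Real.exp_add]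
        congr 1
        ring
      rw [weightSum_succ, weightSum_succ, h₃, h₁ (by omega), hw, rest]
      ring
    · refine ⟨B, fun h' => h₁ (by omega), fun h' => h₂ (by omega), fun t => ?_⟩
      have hw : weight (bump v n c t) n (r - m - 1) = weight v n (r - m - 1) := by
        rcases le_or_gt 0 (r - m - 1 : ℤ) with hj | hj
        · exact weight_congr_of_nonneg hj fun l d hl => bump_of_not (by omega)
        · rw [show (r - m - 1 : ℤ) = -(m + 1 - r) by ring]
          exact weight_congr_of_neg (by omega) fun l d hl => bump_of_not (by omega)
      rw [weightSum_succ, weightSum_succ, h₃, hw, rest]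
      ring

/-- The extension of a finite sequence of vectors by zero. -/
def extendZero {d : ℕ} (z : Fin (d + 1) → Fin r → ℝ) (l : ℤ) : Fin r → ℝ :=
  if h : 0 ≤ l ∧ l < d + 1 then z ⟨l.toNat, by omega⟩ else 0

theorem extendZero_coe {d : ℕ} (z : Fin (d + 1) → Fin r → ℝ) {l : ℤ} (h₀ : 0 ≤ l)
    (h : l < d + 1) : extendZero z l = z ⟨l.toNat, by omega⟩ :=
  dif_pos ⟨h₀, h⟩

theorem extendZero_add_smul {d : ℕ} (z : Fin (d + 1) → Fin r → ℝ) (i : Fin (d + 1)) (c : Fin r)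
    (t : ℝ) : extendZero (z + t • coordVec i c) = bump (extendZero z) i c t := by
  funext l j
  rw [bump]
  by_cases h : 0 ≤ l ∧ l < d + 1
  · rw [extendZero_coe _ h.1 h.2, extendZero_coe _ h.1 h.2, Pi.add_apply, Pi.add_apply,
      Pi.smul_apply, Pi.smul_apply]
    by_cases hl : l = i
    · have hl' : (⟨l.toNat, by omega⟩ : Fin (d + 1)) = i := Fin.ext (by simp [hl])
      rw [hl', coordVec, Pi.single_eq_same]
      by_cases hj : j = c
      · simp [hl, hj]
      · simp [hj]
    · have hl' : (⟨l.toNat, by omega⟩ : Fin (d + 1)) ≠ i := fun h' => hl (by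
        have := congrArg Fin.val h'
        simp only at this
        omega)
      rw [coordVec, Pi.single_eq_of_ne hl', if_neg fun h' => hl h'.1]
      simp
  · rw [extendZero, extendZero, dif_neg h, dif_neg h, if_neg fun h' => h (by omega)]

/-- The coefficient of `T^k` of the reduced shift operator as a function of
`u_n, …, u_{n+r+1}`. -/
def xIntegral (r k : ℕ) (z : Fin (r + 1 + 1) → Fin r → ℝ) : ℝ :=
  weightSum (extendZero z) (2 * r) k 0

theorem contDiff_xIntegral (r k : ℕ) : ContDiff ℝ ∞ (xIntegral r k) := by
  have hv : ∀ l c, ContDiff ℝ ∞ fun z : Fin (r + 1 + 1) → Fin r → ℝ => extendZero z l c := by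
    intro l c
    by_cases h : 0 ≤ l ∧ l < ((r + 1 : ℕ) : ℤ) + 1
    · simp only [extendZero, dif_pos h]
      fun_prop
    · simp only [extendZero, dif_neg h]
      exact contDiff_const
  have hs : ∀ n j, ContDiff ℝ ∞ fun z : Fin (r + 1 + 1) → Fin r → ℝ =>
      reflectSeq (extendZero z) n j := by
    intro n j
    by_cases h : j.natAbs < r
    · simp only [reflectSeq, reflectExt, dif_pos h]
      exact hv _ _
    · simp only [reflectSeq, reflectExt, dif_neg h]
      exact contDiff_const
  have hw : ∀ n j, ContDiff ℝ ∞ fun z : Fin (r + 1 + 1) → Fin r → ℝ =>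
      weight (extendZero z) n j := fun n j =>
    ((((hs _ _).sub (hs _ _)).sub (hs _ _)).add (hs _ _)).exp
  have hS : ∀ m k n, ContDiff ℝ ∞ fun z : Fin (r + 1 + 1) → Fin r → ℝ =>
      weightSum (extendZero z) m k n := by
    intro m
    induction m with
    | zero => intro k n; cases k <;> exact contDiff_const
    | succ m ih =>
      intro k n
      cases k with
      | zero => exact contDiff_const
      | succ k => exact (ih _ _).add ((hw _ _).mul (ih _ _))
  exact hS _ _ _

theorem xIntegral_eq_shiftCoeff (u : ℤ → ℝ → Fin r → ℝ) {k : ℕ} (hk : k ≤ r) (n : ℤ) (x : ℝ) :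
    xIntegral r k (fun l => u (n + (l : ℕ)) x) = shiftCoeff (reduced u) r (2 * r) k n x := by
  have h₁ : xIntegral r k (fun l => u (n + (l : ℕ)) x)
      = weightSum (fun l => u (n + l) x) (2 * r) k 0 := by
    refine weightSum_congr fun l c h₁ h₂ => ?_
    rw [extendZero_coe _ h₁ (by push_cast at h₂ ⊢; omega)]
    simp [Int.toNat_of_nonneg h₁]
  rw [h₁, weightSum_shift (fun l => u l x), add_zero, shiftCoeff_reduced,
    reflectExt_of_le (by omega), reflectExt_of_le (by omega)]
  simp

theorem partialAt_xIntegral {k : ℕ} {i : Fin (r + 1 + 1)} {c : Fin r} {p : ℕ → Fin r → ℝ} {B : ℝ}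
    (h : ∀ t, weightSum (bump (extendZero fun l : Fin (r + 1 + 1) => p l) i c t) (2 * r) k 0
      = weightSum (extendZero fun l : Fin (r + 1 + 1) => p l) (2 * r) k 0
        + B * (Real.exp t - 1)) :
    partialAt (xIntegral r k) i p c = B := by
  refine partialAt_eq_of_hasDerivAt (contDiff_xIntegral r k) ?_
  simp only [xIntegral, extendZero_add_smul, h]
  simpa using (((Real.hasDerivAt_exp 0).sub_const 1).const_mul B).const_add
    (weightSum (extendZero fun l : Fin (r + 1 + 1) => p l) (2 * r) k 0)

theorem exists_xIntegrals (hr : 1 ≤ r) :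
    ∃ (k : Fin r → ℕ) (d : Fin r → ℕ) (J : ∀ i, (Fin (d i + 1) → Fin r → ℝ) → ℝ),
      StrictMono k ∧ (∀ i, k i < 2 * r) ∧
      (∀ i, IsXIntegral (cMatrix r) (d i) (J i)) ∧
      (∀ (u : ℤ → ℝ → Fin r → ℝ) (x₀ : ℝ),
        IsExpSolution (cMatrix r) u x₀ → ∀ (n : ℤ) (i : Fin r),
          J i (fun l => u (n + (l : ℕ)) x₀)
            = shiftCoeff (reduced u) r (2 * r) (k i) n x₀) ∧
      EssentiallyIndependent d J := by
  have hlast : ∀ (p : ℕ → Fin r → ℝ) (i j : Fin r),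
      ((j : ℕ) + i + 1 < r → partialAt (xIntegral r (i + 1)) (Fin.last (r + 1)) p j = 0) ∧
      ((j : ℕ) + i + 1 = r → 0 < partialAt (xIntegral r (i + 1)) (Fin.last (r + 1)) p j) := by
    intro p i j
    by_cases h : (j : ℕ) + i + 1 ≤ r
    · obtain ⟨B, h₁, h₂, h₃⟩ := exists_weightSum_bump_last (m := 2 * r) (b := i + 1)
        (extendZero fun l : Fin (r + 1 + 1) => p l) (by omega) 0 j (by omega)
      have hN : (0 + (2 * r : ℕ) - r + 1 : ℤ) = (Fin.last (r + 1) : ℕ) := by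
        simp only [Fin.val_last]
        push_cast
        ring
      rw [hN] at h₃
      rw [partialAt_xIntegral h₃]
      exact ⟨fun h' => h₁ (by omega), fun h' => h₂ (by omega)⟩
    · exact ⟨fun h' => by omega, fun h' => by omega⟩
  refine ⟨fun i => i + 1, fun _ => r + 1, fun i => xIntegral r (i + 1),
    fun i j hij => Nat.succ_lt_succ hij, fun i => by have := i.isLt; dsimp only; omega,
    fun i => ⟨contDiff_xIntegral _ _, ?_, ?_, ?_⟩,
    fun u x₀ _ n i => xIntegral_eq_shiftCoeff u (by omega) n x₀, fun p => ?_⟩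
  · obtain ⟨B, -, h₂, h₃⟩ := exists_weightSum_bump_first
      (extendZero fun l : Fin (r + 1 + 1) => (0 : ℕ → Fin r → ℝ) l) (2 * r) i.isLt 0 ⟨0, hr⟩ rfl
    refine ⟨0, ⟨0, hr⟩, ?_⟩
    rw [partialAt_xIntegral (B := B) (by simpa using h₃)]
    exact (h₂ (by omega)).ne'
  · exact ⟨0, i.rev, ((hlast 0 i i.rev).2 (by simp; omega)).ne'⟩
  · intro u x₀ hu n
    have e : (fun x => xIntegral r (i + 1) fun l => u (n + (l : ℕ)) x)
        = shiftCoeff (reduced u) r (2 * r) (i + 1) n :=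
      funext fun x => xIntegral_eq_shiftCoeff u (by omega) n x
    obtain ⟨m, hm⟩ : ∃ m, 2 * r = m + 1 := ⟨2 * r - 1, by omega⟩
    dsimp only
    rw [e, hm]
    exact hu.isASolution.hasDerivAt_shiftCoeff_zero (by omega) _ n
  · exact rank_eq_of_antitriangular (fun i j hij => (hlast p i j).1 hij)
      (fun i j hij => ((hlast p i j).2 hij).ne')

end XIntegrals

end SemidiscreteToda

end

theorem mainTheorem2 (r : ℕ) (hr : 1 ≤ r) :
    -- the coefficients of the two products are integrals of the lattice `A` of double length
    (∀ (q : ℤ → ℤ → ℝ → ℝ) (x₀ : ℝ), SemidiscreteToda.IsASolution (1 - (r : ℤ)) r q x₀ →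
      ∀ (n : ℤ) (k : ℕ),
        SemidiscreteToda.diffCoeff q (1 - (r : ℤ)) n (2 * r) k x₀
            = SemidiscreteToda.diffCoeff q (1 - (r : ℤ)) (n + 1) (2 * r) k x₀ ∧
        HasDerivAt (SemidiscreteToda.shiftCoeff q r (2 * r) k n) 0 x₀) ∧
    -- the lattice `C` is the reduction of the lattice `A` by `h_n(-j) = h_{n+j}(j)`
    (∀ u : ℤ → ℝ → Fin r → ℝ,
      (∀ x₀, SemidiscreteToda.IsExpSolution (SemidiscreteToda.cMatrix r) u x₀ ↔
        SemidiscreteToda.IsASolution (1 - (r : ℤ)) r (SemidiscreteToda.reduced u) x₀) ∧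
      ∀ (n j : ℤ) (x : ℝ),
        SemidiscreteToda.laplaceInv (1 - (r : ℤ)) r (SemidiscreteToda.reduced u) n (-j) x
          = SemidiscreteToda.laplaceInv (1 - (r : ℤ)) r (SemidiscreteToda.reduced u) (n + j) j x) ∧
    -- `r` of the `n`-integrals remain essentially independent after the reduction
    (∃ (k : Fin r → ℕ) (d : Fin r → ℕ) (I : ∀ i, (Fin (d i + 1) → Fin r → ℝ) → ℝ),
      StrictMono k ∧ (∀ i, k i < 2 * r) ∧
      (∀ i, SemidiscreteToda.IsNIntegral (SemidiscreteToda.cMatrix r) (d i) (I i)) ∧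
      (∀ (u : ℤ → ℝ → Fin r → ℝ) (x₀ : ℝ),
        SemidiscreteToda.IsExpSolution (SemidiscreteToda.cMatrix r) u x₀ → ∀ (n : ℤ) (i : Fin r),
          I i (SemidiscreteToda.jet (d i) (u n) x₀)
            = SemidiscreteToda.diffCoeff (SemidiscreteToda.reduced u)
                (1 - (r : ℤ)) n (2 * r) (k i) x₀) ∧
      SemidiscreteToda.EssentiallyIndependent d I) ∧
    -- `r` of the `x`-integrals remain essentially independent after the reduction
    (∃ (k : Fin r → ℕ) (d : Fin r → ℕ) (J : ∀ i, (Fin (d i + 1) → Fin r → ℝ) → ℝ),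
      StrictMono k ∧ (∀ i, k i < 2 * r) ∧
      (∀ i, SemidiscreteToda.IsXIntegral (SemidiscreteToda.cMatrix r) (d i) (J i)) ∧
      (∀ (u : ℤ → ℝ → Fin r → ℝ) (x₀ : ℝ),
        SemidiscreteToda.IsExpSolution (SemidiscreteToda.cMatrix r) u x₀ → ∀ (n : ℤ) (i : Fin r),
          J i (fun l => u (n + (l : ℕ)) x₀)
            = SemidiscreteToda.shiftCoeff (SemidiscreteToda.reduced u) r (2 * r) (k i) n x₀) ∧
      SemidiscreteToda.EssentiallyIndependent d J) ∧
    -- the lattice `C` is Darboux integrable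
    SemidiscreteToda.DarbouxIntegrable (SemidiscreteToda.cMatrix r) := by
  obtain ⟨m, hm⟩ : ∃ m, 2 * r = m + 1 := ⟨2 * r - 1, by omega⟩
  have hN := SemidiscreteToda.exists_nIntegrals hr
  have hX := SemidiscreteToda.exists_xIntegrals hr
  refine ⟨fun q x₀ hq n k => ?_, fun u => ⟨fun x₀ => ⟨fun hu => hu.isASolution,
    SemidiscreteToda.isExpSolution_of_isASolution⟩, SemidiscreteToda.laplaceInv_reduced_neg u⟩,
    hN, hX, ?_, ?_⟩
  · rw [hm]
    exact ⟨hq.diffCoeff_succ (by omega) n k, hq.hasDerivAt_shiftCoeff_zero (by omega) k n⟩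
  · obtain ⟨-, d, I, -, -, h₁, -, h₂⟩ := hN
    exact ⟨d, I, h₁, h₂⟩
  · obtain ⟨-, d, J, -, -, h₁, -, h₂⟩ := hX
    exact ⟨d, J, h₁, h₂⟩
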